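/- **Setting.** Let $\mathcal M=(\mathcal S,\mathcal A,p,r,\gamma,\rho)$ be a finite MDP with $S=|\mathcal S|$ states and $A=|\mathcal A|$ actions, deterministic rewards $r(s,a)\in[0,1]$, discount $\gamma\in[0,1)$ and initial distribution $\rho$ with $\rho(s)>0$ for all $s$. For a stationary stochastic policy $\pi$ let $F(\pi)=\mathbf E\sum_{t\ge0}\gamma^t r(s_t,a_t)$, where $s_0\sim\rho$, $a_t\sim\pi(\cdot|s_t)$, $s_{t+1}\sim p(\cdot|s_t,a_t)$; let $F^\star=\max_\pi F(\pi)$, let $\pi^\star$ be any maximizer, and let $d_\rho^{\pi}(s)=(1-\gamma)\sum_{t\ge0}\gamma^t\,\mathbf{Prob}_\pi(s_t=s\mid s_0\sim\rho)$. Division in $d_\rho^{\pi}/\rho$ is component-wise. For $\theta\in\mathbf R^{SA}$ let $\pi_\theta(s,a)=e^{\theta_{s,a}}/\sum_{a'}e^{\theta_{s,a'}}$, $R(\theta)=\frac1{SA}\sum_{s,a}\log\pi_\theta(s,a)$, $L_\lambda(\theta)=F(\pi_\theta)+\lambda R(\theta)$ and $\beta_\lambda=\frac{8}{(1-\gamma)^3}+\frac{2\lambda}{S}$.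 **Algorithm.** The phased policy gradient method has phases $l=0,1,\dots$ of lengths $T_l\ge1$, step sizes $\alpha^{l,k}$, regularization parameters $\lambda^l\geq 0$, and a post-processing map $\mathtt{PP}$ of $\mathbf R^{SA}$ whose outputs $\theta'$ satisfy $\pi_{\theta'}(s,a)\ge\epsilon_{\rm pp}$ for all $s,a$, for a fixed $\epsilon_{\rm pp}\in(0,1/A]$. It starts at $\theta^{0,0}=\mathtt{PP}(\tilde\theta^{0,0})$. In episode $k<T_l$ of phase $l$ it samples one trajectory $(s^{l,k}_t,a^{l,k}_t)_{t\leq H^{l,k}}$ of finite, possibly random length from $\mathcal M$ following $\pi_{\theta^{l,k}}$, which given $\theta^{l,k}$ is conditionally independent of all previous iterates and trajectories, computes a gradient estimate $\widehat\nabla L_{\lambda^l}(\theta^{l,k})$ from $\theta^{l,k}$ and this trajectory, and sets $\theta^{l,k+1}=\theta^{l,k}+\alpha^{l,k}\widehat\nabla L_{\lambda^l}(\theta^{l,k})$. The next phase starts at $\theta^{l+1,0}=\mathtt{PP}(\theta^{l,T_l})$. Write $\mathbf E_{l,k}$ for the conditional expectation given $\theta^{l,k}$, and $$\mathbf{regret}_l(K)=\sum_{k=0}^{K}\Big(F^\star-\mathbf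 E_{l,k}\sum_{t=0}^{H^{l,k}}\gamma^t r(s^{l,k}_t,a^{l,k}_t)\Big).$$ **Theorem.** Fix a phase $l\ge0$. Suppose that there are constants $C,C_1,C_2,M_1,M_2>0$ and reals $\delta_{l,k}$ with $\sum_{k=0}^{T_l-1}\delta_{l,k}^2\le C$ such that for all $0\le k<T_l$, almost surely, $\|\widehat\nabla L_{\lambda^l}(\theta^{l,k})\|_2\le C_1$, $$\nabla L_{\lambda^l}(\theta^{l,k})^T\,\mathbf E_{l,k}\widehat\nabla L_{\lambda^l}(\theta^{l,k})\ge C_2\|\nabla L_{\lambda^l}(\theta^{l,k})\|_2^2-\delta_{l,k},$$ $$\mathbf E_{l,k}\|\widehat\nabla L_{\lambda^l}(\theta^{l,k})\|_2^2\le M_1+M_2\|\nabla L_{\lambda^l}(\theta^{l,k})\|_2^2,$$ and $H^{l,k}\ge\log_{1/\gamma}(k+1)$ (for $\gamma=0$ this last condition is void). Let $\alpha^{l,k}=C_{l,\alpha}\frac{1}{\sqrt{k+3}\,\log_2(k+3)}$ with $0<C_{l,\alpha}\le C_2/(M_2\beta_{\lambda^l})$, and let $\lambda^l=\epsilon(1-\gamma)/2$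 with $\epsilon>0$. Put $$E_l=\frac{C_{l,\alpha}(1-\gamma)^2}{16S^2A^2},\qquad C_l=32C_1^2C_{l,\alpha}^2\Big(\frac1{(1-\gamma)^2}+\lambda^l\Big)^2+\frac{\beta_{\lambda^l}^2C_1^4C_{l,\alpha}^4}{2},$$ $$D_l=C\,C_{l,\alpha}^2+\beta_{\lambda^l}M_1C_{l,\alpha}^2+F^\star-L_{\lambda^l}(\theta^{l,0}),\qquad U_1=\frac{4\big(D_l/\sqrt{\log 2}+\sqrt{2C_l}\big)}{(1-\gamma)C_2E_l}.$$ Then for every $\delta\in(0,1)$, with probability at least $1-\delta$, simultaneously for all $K\in\{0,\dots,T_l-1\}$, $$\mathbf{regret}_l(K)\le\frac{4\big(D_l+\sqrt{2C_l\log(2/\delta)}\big)}{(1-\gamma)C_2E_l\,\epsilon^2}\sqrt{K+1}\,\log_2(K+3)+\epsilon(K+1)\Big\|\frac{d_\rho^{\pi^\star}}{\rho}\Big\|_\infty+\frac{\gamma+\gamma\log(K+1)}{1-\gamma}$$ and $$\mathbf{regret}_l(K)\le U_1\,\frac{\sqrt{K+1}\,\log_2(K+3)\,\sqrt{\log(2/\delta)}}{\epsilon^2}+(K+1)\Big\|\frac{d_\rho^{\pi^\star}}{\rho}\Big\|_\infty\epsilon+\frac{2\gamma}{1-\gamma}\log(K+3).$$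 In particular $U_1$ depends only on $\mathcal M$, $\theta^{l,0}$, $C$, $C_1$, $C_2$, $M_1$, $C_{l,\alpha}$ and $\lambda^l$. -/

import Mathlib

open MeasureTheory

/-- A finite discounted MDP: transition probabilities `p s a s'`, deterministic rewards
`r s a ∈ [0,1]`, discount factor `γ ∈ [0,1)`, and a component-wise positive initial state
distribution `ρ`. -/
structure FiniteMDP (S A : Type*) [Fintype S] [Fintype A] where
  p : S → A → S → ℝ
  p_nonneg : ∀ s a s', 0 ≤ p s a s'
  p_sum : ∀ s a, ∑ s', p s a s' = 1
  r : S → A → ℝ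
  r_nonneg : ∀ s a, 0 ≤ r s a
  r_le_one : ∀ s a, r s a ≤ 1
  γ : ℝ
  γ_nonneg : 0 ≤ γ
  γ_lt_one : γ < 1
  ρ : S → ℝ
  ρ_pos : ∀ s, 0 < ρ s
  ρ_sum : ∑ s, ρ s = 1

/-- `π` is a stationary stochastic policy, `π s a` being the probability of `a` in state `s`. -/
def IsPolicy {S A : Type*} [Fintype A] (π : S → A → ℝ) : Prop :=
  (∀ s a, 0 ≤ π s a) ∧ ∀ s, ∑ a, π s a = 1

/-- The parameter space `ℝ^{SA}` with the Euclidean norm. -/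
abbrev Param (S A : Type*) := EuclideanSpace ℝ (S × A)

section Policy

variable {S A : Type*} [Fintype S] [Fintype A]

/-- The soft-max policy `π_θ(s,a) = exp(θ_{s,a}) / ∑_{a'} exp(θ_{s,a'})`. -/
noncomputable def softmaxPolicy (θ : Param S A) (s : S) (a : A) : ℝ :=
  Real.exp (θ (s, a)) / ∑ a', Real.exp (θ (s, a'))

/-- The log-barrier regularization `R(θ) = (1/(SA)) ∑_{s,a} log π_θ(s,a)`. -/
noncomputable def logBarrier (θ : Param S A) : ℝ :=
  1 / ((Fintype.card S : ℝ) * Fintype.card A) * ∑ s, ∑ a, Real.log (softmaxPolicy θ s a)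

namespace FiniteMDP

/-- Probability that the first `t + 1` state-action pairs are `x 0, …, x t`, when
`s_0 ∼ ρ`, `a_i ∼ π(·|s_i)` and `s_{i+1} ∼ p(·|s_i,a_i)`. -/
noncomputable def pathProb (M : FiniteMDP S A) (π : S → A → ℝ) {t : ℕ}
    (x : Fin (t + 1) → S × A) : ℝ :=
  M.ρ (x 0).1 * π (x 0).1 (x 0).2 *
    ∏ i : Fin t, (M.p (x i.castSucc).1 (x i.castSucc).2 (x i.succ).1 *
      π (x i.succ).1 (x i.succ).2)

/-- Expectation of `f (s_t, a_t)` when following the policy `π` from `s_0 ∼ ρ`. -/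
noncomputable def expectAt (M : FiniteMDP S A) (π : S → A → ℝ) (t : ℕ) (f : S × A → ℝ) : ℝ :=
  ∑ x : Fin (t + 1) → S × A, M.pathProb π x * f (x (Fin.last t))

open Classical in
/-- `Prob_π(s_t = s | s_0 ∼ ρ)`. -/
noncomputable def stateProb (M : FiniteMDP S A) (π : S → A → ℝ) (t : ℕ) (s : S) : ℝ :=
  M.expectAt π t (fun z => if z.1 = s then 1 else 0)

/-- The expected cumulative discounted reward `F(π)`. -/
noncomputable def F (M : FiniteMDP S A) (π : S → A → ℝ) : ℝ :=
  ∑' t : ℕ, M.γ ^ t * M.expectAt π t (fun z => M.r z.1 z.2)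

/-- The optimal value `F^⋆`, the supremum of `F` over all policies. -/
noncomputable def optValue (M : FiniteMDP S A) : ℝ :=
  sSup (M.F '' {π | IsPolicy π})

/-- `π` is an optimal policy: a maximizer of `F` over all policies. -/
def IsOptimal (M : FiniteMDP S A) (π : S → A → ℝ) : Prop :=
  IsPolicy π ∧ ∀ π', IsPolicy π' → M.F π' ≤ M.F π

/-- The discounted state visitation distribution
`d_ρ^π(s) = (1-γ) ∑_t γ^t Prob_π(s_t = s | s_0 ∼ ρ)`. -/
noncomputable def visitation (M : FiniteMDP S A) (π : S → A → ℝ) (s : S) : ℝ :=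
  (1 - M.γ) * ∑' t : ℕ, M.γ ^ t * M.stateProb π t s

/-- `‖d_ρ^π / ρ‖_∞`, with component-wise division (the norm of `S → ℝ` is the sup norm). -/
noncomputable def mismatch (M : FiniteMDP S A) (π : S → A → ℝ) : ℝ :=
  ‖fun s : S => M.visitation π s / M.ρ s‖

/-- The regularized objective `L_λ(θ) = F(π_θ) + λ R(θ)`. -/
noncomputable def regObjective (M : FiniteMDP S A) (lam : ℝ) (θ : Param S A) : ℝ :=
  M.F (softmaxPolicy θ) + lam * logBarrier θ

/-- The smoothness constant `β_λ = 8/(1-γ)^3 + 2λ/S`. -/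
noncomputable def smoothConst (M : FiniteMDP S A) (lam : ℝ) : ℝ :=
  8 / (1 - M.γ) ^ 3 + 2 * lam / Fintype.card S

end FiniteMDP

end Policy

/-- The inputs of the phased policy gradient method. `estimator l k θ τ` is the approximate
gradient of `L_{λ^l}` at `θ` computed from the finite trajectory `τ` (a list of state-action
pairs; rewards are determined by them) in episode `k` of phase `l`. -/
structure PhasedPGInput (S A : Type*) [Fintype S] [Fintype A] where
  /-- the initial parameter, before post-processing -/
  θinit : Param S A
  /-- step sizes `α^{l,k}` -/
  α : ℕ → ℕ → ℝ
  /-- regularization parameters `λ^l` -/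
  lam : ℕ → ℝ
  lam_nonneg : ∀ l, 0 ≤ lam l
  /-- phase lengths `T_l` -/
  T : ℕ → ℕ
  T_pos : ∀ l, 0 < T l
  /-- post-processing tolerance -/
  εpp : ℝ
  εpp_pos : 0 < εpp
  εpp_le : εpp ≤ 1 / (Fintype.card A : ℝ)
  postprocess : Param S A → Param S A
  postprocess_measurable : Measurable postprocess
  postprocess_ge : ∀ θ s a, εpp ≤ softmaxPolicy (postprocess θ) s a
  estimator : ℕ → ℕ → Param S A → List (S × A) → Param S A
  estimator_measurable : ∀ l k τ, Measurable fun θ => estimator l k θ τ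

section Run

variable {S A : Type*} [Fintype S] [Fintype A] {Ω : Type*}

/-- The trajectory of episode `k` of phase `l`, stopped at time `H^{l,k}`. Here `X l k t` is the
state-action pair at time `t`. -/
def stoppedTraj (X : ℕ → ℕ → ℕ → Ω → S × A) (H : ℕ → ℕ → Ω → ℕ) (l k : ℕ) (ω : Ω) :
    List (S × A) :=
  List.ofFn fun i : Fin (H l k ω + 1) => X l k i ω

/-- The gradient estimate `∇̂L_{λ^l}(θ^{l,k})` computed in episode `k` of phase `l`. -/
def gradEst (P : PhasedPGInput S A) (θ : ℕ → ℕ → Ω → Param S A) (X : ℕ → ℕ → ℕ → Ω → S × A)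
    (H : ℕ → ℕ → Ω → ℕ) (l k : ℕ) (ω : Ω) : Param S A :=
  P.estimator l k (θ l k ω) (stoppedTraj X H l k ω)

/-- The σ-algebra generated by the iterate `θ^{l,k}`. -/
abbrev sigmaIter (θ : ℕ → ℕ → Ω → Param S A) (l k : ℕ) : MeasurableSpace Ω :=
  MeasurableSpace.comap (θ l k) inferInstance

/-- The σ-algebra generated by the trajectory of episode `(l,k)` and its length. -/
abbrev sigmaTraj (X : ℕ → ℕ → ℕ → Ω → S × A) (H : ℕ → ℕ → Ω → ℕ) (l k : ℕ) : MeasurableSpace Ω :=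
  (⨆ t : ℕ, MeasurableSpace.comap (X l k t) ⊤) ⊔ MeasurableSpace.comap (H l k) ⊤

/-- The history at episode `(l,k)`: all iterates up to and including `θ^{l,k}` and all earlier
trajectories, where `T` are the phase lengths. -/
abbrev sigmaHist (T : ℕ → ℕ) (θ : ℕ → ℕ → Ω → Param S A) (X : ℕ → ℕ → ℕ → Ω → S × A)
    (H : ℕ → ℕ → Ω → ℕ) (l k : ℕ) : MeasurableSpace Ω :=
  (⨆ (j : ℕ) (i : ℕ) (_ : (j < l ∧ i ≤ T j) ∨ (j = l ∧ i ≤ k)), sigmaIter θ j i) ⊔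
    (⨆ (j : ℕ) (i : ℕ) (_ : (j < l ∧ i < T j) ∨ (j = l ∧ i < k)), sigmaTraj X H j i)

variable [MeasurableSpace Ω]

/-- The random variables `θ`, `X`, `H` on `(Ω, μ)` form a run of the phased policy gradient method
on the MDP `M` with inputs `P`: `θ l k` is the iterate `θ^{l,k}`, `X l k t` is the pair
`(s_t^{l,k}, a_t^{l,k})` and `H l k` is the (possibly random) trajectory length. -/
structure IsPhasedPGRun (M : FiniteMDP S A) (P : PhasedPGInput S A) (μ : Measure Ω)
    (θ : ℕ → ℕ → Ω → Param S A) (X : ℕ → ℕ → ℕ → Ω → S × A) (H : ℕ → ℕ → Ω → ℕ) : Prop where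
  traj_measurable : ∀ l k, k < P.T l → ∀ t z, MeasurableSet {ω | X l k t ω = z}
  length_measurable : ∀ l k, k < P.T l → Measurable (H l k)
  init : ∀ ω, θ 0 0 ω = P.postprocess P.θinit
  update : ∀ l k, k < P.T l → ∀ ω, θ l (k + 1) ω = θ l k ω + P.α l k • gradEst P θ X H l k ω
  next_phase : ∀ l ω, θ (l + 1) 0 ω = P.postprocess (θ l (P.T l) ω)
  /-- Given `θ^{l,k}`, the trajectory is sampled from `M` following the policy `π_{θ^{l,k}}`. -/
  sampling : ∀ l k, k < P.T l → ∀ (t : ℕ) (x : Fin (t + 1) → S × A),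
    μ[Set.indicator {ω | ∀ i : Fin (t + 1), X l k i ω = x i} (fun _ => (1 : ℝ)) | sigmaIter θ l k]
      =ᵐ[μ] fun ω => M.pathProb (softmaxPolicy (θ l k ω)) x
  /-- Given `θ^{l,k}`, the trajectory is conditionally independent of all previous iterates and
  trajectories. -/
  condIndep : ∀ l k, k < P.T l → ∀ B : Set Ω, MeasurableSet[sigmaTraj X H l k] B →
    μ[Set.indicator B (fun _ => (1 : ℝ)) | sigmaHist P.T θ X H l k]
      =ᵐ[μ] μ[Set.indicator B (fun _ => (1 : ℝ)) | sigmaIter θ l k]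

/-- The assumption on the policy gradient estimator and on the trajectory lengths, in phase `l`,
with constants `C`, `C₁`, `C₂`, `M₁`, `M₂`; `E_{l,k}` is the conditional expectation given
`θ^{l,k}`. -/
structure GradEstAssumption (M : FiniteMDP S A) (P : PhasedPGInput S A) (μ : Measure Ω)
    (θ : ℕ → ℕ → Ω → Param S A) (X : ℕ → ℕ → ℕ → Ω → S × A) (H : ℕ → ℕ → Ω → ℕ) (l : ℕ)
    (C C₁ C₂ M₁ M₂ : ℝ) : Prop where
  C_pos : 0 < C
  C₁_pos : 0 < C₁
  C₂_pos : 0 < C₂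
  M₁_pos : 0 < M₁
  M₂_pos : 0 < M₂
  bounded : ∀ k < P.T l, ∀ᵐ ω ∂μ, ‖gradEst P θ X H l k ω‖ ≤ C₁
  nearly_unbiased : ∃ δ : ℕ → ℝ, (∑ k ∈ Finset.range (P.T l), δ k ^ 2 ≤ C) ∧
    ∀ k < P.T l, ∀ᵐ ω ∂μ,
      C₂ * ‖gradient (M.regObjective (P.lam l)) (θ l k ω)‖ ^ 2 - δ k ≤
        inner ℝ (gradient (M.regObjective (P.lam l)) (θ l k ω))
          ((μ[gradEst P θ X H l k | sigmaIter θ l k]) ω)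
  second_moment : ∀ k < P.T l, ∀ᵐ ω ∂μ,
    (μ[fun ω' => ‖gradEst P θ X H l k ω'‖ ^ 2 | sigmaIter θ l k]) ω ≤
      M₁ + M₂ * ‖gradient (M.regObjective (P.lam l)) (θ l k ω)‖ ^ 2
  length : ∀ k < P.T l, ∀ᵐ ω ∂μ, Real.logb (1 / M.γ) ((k : ℝ) + 1) ≤ H l k ω

/-- `F̂^{l,k}(π_{θ^{l,k}}) = E_{l,k} ∑_{t=0}^{H^{l,k}} γ^t r(s_t^{l,k}, a_t^{l,k})`. -/
noncomputable def truncValue (M : FiniteMDP S A) (μ : Measure Ω)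
    (θ : ℕ → ℕ → Ω → Param S A) (X : ℕ → ℕ → ℕ → Ω → S × A) (H : ℕ → ℕ → Ω → ℕ)
    (l k : ℕ) : Ω → ℝ :=
  μ[fun ω => ∑ t ∈ Finset.range (H l k ω + 1), M.γ ^ t * M.r (X l k t ω).1 (X l k t ω).2 |
    sigmaIter θ l k]

/-- `regret_l(K) = ∑_{k=0}^K (F^⋆ - F̂^{l,k}(π_{θ^{l,k}}))`. -/
noncomputable def phaseRegret (M : FiniteMDP S A) (μ : Measure Ω)
    (θ : ℕ → ℕ → Ω → Param S A) (X : ℕ → ℕ → ℕ → Ω → S × A) (H : ℕ → ℕ → Ω → ℕ)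
    (l K : ℕ) (ω : Ω) : ℝ :=
  ∑ k ∈ Finset.range (K + 1), (M.optValue - truncValue M μ θ X H l k ω)

end Run

section Constants

variable {S A : Type*} [Fintype S] [Fintype A]

namespace FiniteMDP

/-- `E_l = C_{l,α} (1-γ)^2 / (16 S^2 A^2)`. -/
noncomputable def constE (M : FiniteMDP S A) (Cα : ℝ) : ℝ :=
  Cα * (1 - M.γ) ^ 2 / (16 * (Fintype.card S : ℝ) ^ 2 * (Fintype.card A : ℝ) ^ 2)

/-- `C_l = 32 C₁² C_{l,α}² (1/(1-γ)² + λ^l)² + β_{λ^l}² C₁⁴ C_{l,α}⁴ / 2`. -/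
noncomputable def constC (M : FiniteMDP S A) (C₁ Cα lam : ℝ) : ℝ :=
  32 * C₁ ^ 2 * Cα ^ 2 * (1 / (1 - M.γ) ^ 2 + lam) ^ 2 +
    M.smoothConst lam ^ 2 * C₁ ^ 4 * Cα ^ 4 / 2

/-- `D_l = C C_{l,α}² + β_{λ^l} M₁ C_{l,α}² + F^⋆ - L_{λ^l}(θ^{l,0})`, where `θ₀ = θ^{l,0}`. -/
noncomputable def constD (M : FiniteMDP S A) (C M₁ Cα lam : ℝ) (θ₀ : Param S A) : ℝ :=
  C * Cα ^ 2 + M.smoothConst lam * M₁ * Cα ^ 2 + M.optValue - M.regObjective lam θ₀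

/-- `U₁ = 4 (D_l / √(log 2) + √(2 C_l)) / ((1-γ) C₂ E_l)`, a function of the MDP, the phase
initialization `θ₀ = θ^{l,0}` and the constants `C`, `C₁`, `C₂`, `M₁`, `C_{l,α}`, `λ^l` only. -/
noncomputable def constU (M : FiniteMDP S A) (C C₁ C₂ M₁ Cα lam : ℝ) (θ₀ : Param S A) : ℝ :=
  4 * (M.constD C M₁ Cα lam θ₀ / √(Real.log 2) + √(2 * M.constC C₁ Cα lam)) /
    ((1 - M.γ) * C₂ * M.constE Cα)

end FiniteMDP

end Constants

set_option linter.unusedSectionVars false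

/-! The regularized objective is smooth from below, so a step α along an estimate g raises it by at
least α⟨∇L, g⟩ − (β/2)α²‖g‖². Because α is at most half of C₂/(M₂β), the conditional mean of this
gain is at least (3/4)αC₂‖∇L‖² − αδ_k − (β/2)M₁α². What remains is a martingale difference
(`regObjective_ascent`). A maximal Azuma–Hoeffding inequality (`measure_exists_sum_range_ge_le`)
bounds all its partial sums at once by N = √(2C_l log(2/δ)), which makes the result uniform in K.
Since L_λ ≤ F ≤ F⋆, telescoping bounds the weighted sum of the squared gradient norms.

Gradient domination (`F_sub_le_of_norm_gradient_le`) turns this into regret. If ‖∇L_λ‖ ≤ κ =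
λ/(2SA), the optimality gap is at most λ/(1−γ) = ε/2 times the mismatch coefficient. Every other
episode uses up at least (3/4)α_K C₂κ² of the telescoped budget, so there are O(√K log K/κ²) of
them, each with gap at most 1/(1−γ). `sum_gap_le` carries out this deterministic count.

Stopping a trajectory at H ≥ log_{1/γ}(k+1) loses at most γ/((1−γ)(k+1)) of expected reward
(`F_le_truncValue_add`), and these losses form a harmonic sum. The second bound is a coarsening of
the first, using log(2/δ) ≥ log 2. -/

namespace FiniteMDP

/-! ### Paths, discounted occupancy and the performance difference identity. -/

section Paths

variable {S A : Type*} [Fintype S] [Fintype A] (M : FiniteMDP S A) {π : S → A → ℝ}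

theorem pathProb_nonneg (hπ : IsPolicy π) {t : ℕ} (x : Fin (t + 1) → S × A) :
    0 ≤ M.pathProb π x :=
  mul_nonneg (mul_nonneg (M.ρ_pos _).le (hπ.1 _ _))
    (Finset.prod_nonneg fun _ _ => mul_nonneg (M.p_nonneg _ _ _) (hπ.1 _ _))

theorem pathProb_snoc (π : S → A → ℝ) {t : ℕ} (x : Fin (t + 1) → S × A) (z : S × A) :
    M.pathProb π (Fin.snoc x z : Fin (t + 2) → S × A) =
      M.pathProb π x * (M.p (x (Fin.last t)).1 (x (Fin.last t)).2 z.1 * π z.1 z.2) := by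
  unfold pathProb
  have h0 : (Fin.snoc x z : Fin (t + 2) → S × A) 0 = x 0 := by
    rw [← Fin.castSucc_zero, Fin.snoc_castSucc (α := fun _ => S × A)]
  rw [Fin.prod_univ_castSucc, h0]
  simp only [Fin.succ_last, Fin.succ_castSucc, Fin.snoc_castSucc (α := fun _ => S × A),
    Fin.snoc_last (α := fun _ => S × A)]
  ring

theorem expectAt_zero (π : S → A → ℝ) (f : S × A → ℝ) :
    M.expectAt π 0 f = ∑ s, ∑ a, M.ρ s * π s a * f (s, a) := by
  unfold expectAt pathProb
  rw [← Fintype.sum_prod_type', ← (Equiv.funUnique (Fin 1) (S × A)).symm.sum_comp]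
  simp [Fin.last]

theorem expectAt_succ (π : S → A → ℝ) (t : ℕ) (f : S × A → ℝ) :
    M.expectAt π (t + 1) f =
      M.expectAt π t (fun z => ∑ s', M.p z.1 z.2 s' * ∑ a', π s' a' * f (s', a')) := by
  unfold expectAt
  rw [← (Fin.snocEquiv (fun _ : Fin (t + 2) => S × A)).sum_comp, Fintype.sum_prod_type,
    Finset.sum_comm]
  refine Finset.sum_congr rfl fun x _ => ?_
  simp only [Fin.snocEquiv, Equiv.coe_fn_mk]
  simp only [Fin.snoc_last (α := fun _ => S × A), Finset.mul_sum]
  rw [← Fintype.sum_prod_type']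
  refine Finset.sum_congr rfl fun z _ => ?_
  change M.pathProb π (Fin.snoc x z : Fin (t + 2) → S × A) * f z = _
  rw [M.pathProb_snoc π x z]
  ring

theorem expectAt_const (hπ : IsPolicy π) (t : ℕ) (c : ℝ) :
    M.expectAt π t (fun _ => c) = c := by
  induction t with
  | zero => simp [expectAt_zero, ← Finset.sum_mul, ← Finset.mul_sum, hπ.2, M.ρ_sum]
  | succ t ih => simp [expectAt_succ, ← Finset.sum_mul, hπ.2, M.p_sum, ih]

theorem sum_pathProb (hπ : IsPolicy π) (t : ℕ) :
    ∑ x : Fin (t + 1) → S × A, M.pathProb π x = 1 := by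
  simpa [expectAt] using M.expectAt_const hπ t 1

theorem expectAt_mono (hπ : IsPolicy π) (t : ℕ) {f g : S × A → ℝ} (h : ∀ z, f z ≤ g z) :
    M.expectAt π t f ≤ M.expectAt π t g :=
  Finset.sum_le_sum fun x _ => mul_le_mul_of_nonneg_left (h _) (M.pathProb_nonneg hπ x)

theorem expectAt_add (π : S → A → ℝ) (t : ℕ) (f g : S × A → ℝ) :
    M.expectAt π t (fun z => f z + g z) = M.expectAt π t f + M.expectAt π t g := by
  simp [expectAt, mul_add, Finset.sum_add_distrib]

theorem expectAt_sub (π : S → A → ℝ) (t : ℕ) (f g : S × A → ℝ) :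
    M.expectAt π t (fun z => f z - g z) = M.expectAt π t f - M.expectAt π t g := by
  simp [expectAt, mul_sub, Finset.sum_sub_distrib]

theorem expectAt_const_mul (π : S → A → ℝ) (t : ℕ) (c : ℝ) (f : S × A → ℝ) :
    M.expectAt π t (fun z => c * f z) = c * M.expectAt π t f := by
  simp only [expectAt, Finset.mul_sum]
  exact Finset.sum_congr rfl fun _ _ => by ring

theorem expectAt_sum {ι : Type*} (s : Finset ι) (π : S → A → ℝ) (t : ℕ) (f : ι → S × A → ℝ) :
    M.expectAt π t (fun z => ∑ i ∈ s, f i z) = ∑ i ∈ s, M.expectAt π t (f i) := by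
  simp only [expectAt, Finset.mul_sum]
  exact Finset.sum_comm

theorem expectAt_nonneg (hπ : IsPolicy π) (t : ℕ) {f : S × A → ℝ} (h : ∀ z, 0 ≤ f z) :
    0 ≤ M.expectAt π t f := by
  simpa [M.expectAt_const hπ] using M.expectAt_mono hπ t h

theorem expectAt_le (hπ : IsPolicy π) (t : ℕ) {f : S × A → ℝ} {c : ℝ} (h : ∀ z, f z ≤ c) :
    M.expectAt π t f ≤ c := by
  simpa [M.expectAt_const hπ] using M.expectAt_mono hπ t h

theorem abs_expectAt_le (hπ : IsPolicy π) (t : ℕ) {f : S × A → ℝ} {c : ℝ} (h : ∀ z, |f z| ≤ c) :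
    |M.expectAt π t f| ≤ c := by
  rw [abs_le]
  refine ⟨?_, M.expectAt_le hπ t fun z => (le_abs_self _).trans (h z)⟩
  simpa [M.expectAt_const hπ] using
    M.expectAt_mono hπ t (f := fun _ => -c) fun z => neg_le_of_abs_le (h z)

theorem expectAt_average (hπ : IsPolicy π) (t : ℕ) (g : S × A → ℝ) :
    M.expectAt π t g = M.expectAt π t (fun z => ∑ a, π z.1 a * g (z.1, a)) := by
  cases t with
  | zero =>
    simp only [expectAt_zero, mul_assoc, ← Finset.mul_sum, ← Finset.sum_mul, hπ.2, one_mul]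
  | succ t =>
    simp only [expectAt_succ, ← Finset.sum_mul, hπ.2, one_mul]

theorem expectAt_succ_fst (hπ : IsPolicy π) (t : ℕ) (V : S → ℝ) :
    M.expectAt π (t + 1) (fun z => V z.1) =
      M.expectAt π t (fun z => ∑ s', M.p z.1 z.2 s' * V s') := by
  simp only [expectAt_succ, ← Finset.sum_mul, hπ.2, one_mul]

theorem expectAt_fst (π : S → A → ℝ) (t : ℕ) (h : S → ℝ) :
    M.expectAt π t (fun z => h z.1) = ∑ s, h s * M.stateProb π t s := by
  classical
  simp only [stateProb, ← expectAt_const_mul, ← expectAt_sum]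
  congr 1
  ext z
  simp

theorem stateProb_nonneg (hπ : IsPolicy π) (t : ℕ) (s : S) : 0 ≤ M.stateProb π t s :=
  M.expectAt_nonneg hπ t fun z => by split_ifs <;> norm_num

theorem stateProb_le_one (hπ : IsPolicy π) (t : ℕ) (s : S) : M.stateProb π t s ≤ 1 :=
  M.expectAt_le hπ t fun z => by split_ifs <;> norm_num

theorem stateProb_zero (hπ : IsPolicy π) (s : S) : M.stateProb π 0 s = M.ρ s := by
  classical
  simp [stateProb, expectAt_zero, ← Finset.mul_sum, hπ.2]

theorem summable_geometric_mul {u : ℕ → ℝ} {c : ℝ} (hu : ∀ t, |u t| ≤ c) :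
    Summable fun t => M.γ ^ t * u t := by
  refine Summable.of_norm_bounded
    ((summable_geometric_of_lt_one M.γ_nonneg M.γ_lt_one).mul_right c) fun t => ?_
  rw [norm_mul, Real.norm_eq_abs, Real.norm_eq_abs, abs_of_nonneg (pow_nonneg M.γ_nonneg t)]
  exact mul_le_mul_of_nonneg_left (hu t) (pow_nonneg M.γ_nonneg t)

theorem one_sub_γ_pos : 0 < 1 - M.γ := sub_pos.2 M.γ_lt_one

theorem summable_stateProb (hπ : IsPolicy π) (s : S) :
    Summable fun t => M.γ ^ t * M.stateProb π t s :=
  M.summable_geometric_mul (c := 1) fun t => by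
    rw [abs_of_nonneg (M.stateProb_nonneg hπ t s)]; exact M.stateProb_le_one hπ t s

/-- The unnormalized discounted visitation measure. -/
noncomputable def occupancy (π : S → A → ℝ) (s : S) : ℝ := ∑' t : ℕ, M.γ ^ t * M.stateProb π t s

theorem visitation_eq (π : S → A → ℝ) (s : S) :
    M.visitation π s = (1 - M.γ) * M.occupancy π s := rfl

theorem ρ_le_occupancy (hπ : IsPolicy π) (s : S) : M.ρ s ≤ M.occupancy π s := by
  have := (M.summable_stateProb hπ s).le_tsum 0 fun t _ =>
    mul_nonneg (pow_nonneg M.γ_nonneg t) (M.stateProb_nonneg hπ t s)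
  simpa [M.stateProb_zero hπ, occupancy] using this

theorem occupancy_pos (hπ : IsPolicy π) (s : S) : 0 < M.occupancy π s :=
  (M.ρ_pos s).trans_le (M.ρ_le_occupancy hπ s)

theorem abs_expectAt_r_le (hπ : IsPolicy π) (t : ℕ) :
    |M.expectAt π t (fun z => M.r z.1 z.2)| ≤ 1 :=
  M.abs_expectAt_le hπ t fun z => by
    rw [abs_of_nonneg (M.r_nonneg _ _)]; exact M.r_le_one _ _

theorem summable_F (hπ : IsPolicy π) :
    Summable fun t => M.γ ^ t * M.expectAt π t (fun z => M.r z.1 z.2) :=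
  M.summable_geometric_mul (M.abs_expectAt_r_le hπ)

theorem F_nonneg (hπ : IsPolicy π) : 0 ≤ M.F π :=
  tsum_nonneg fun t => mul_nonneg (pow_nonneg M.γ_nonneg t)
    (M.expectAt_nonneg hπ t fun _ => M.r_nonneg _ _)

theorem F_le (hπ : IsPolicy π) : M.F π ≤ 1 / (1 - M.γ) := by
  rw [one_div, ← tsum_geometric_of_lt_one M.γ_nonneg M.γ_lt_one]
  refine (M.summable_F hπ).tsum_le_tsum (fun t => ?_)
    (summable_geometric_of_lt_one M.γ_nonneg M.γ_lt_one)
  exact mul_le_of_le_one_right (pow_nonneg M.γ_nonneg t)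
    ((le_abs_self _).trans (M.abs_expectAt_r_le hπ t))

/-- The advantage of the state-action pair `z` relative to the value function `V`. -/
noncomputable def advantage (V : S → ℝ) (z : S × A) : ℝ :=
  M.r z.1 z.2 + M.γ * ∑ s', M.p z.1 z.2 s' * V s' - V z.1

/-- Adding γV(s_{t+1}) − V(s_t) to each reward changes the discounted sum by a telescoping series
with value −E V(s₀), whatever V is. The freedom in V serves twice: to compare two policies through
one V, and to differentiate F along a line with V frozen. -/
theorem hasSum_advantage (hπ : IsPolicy π) (V : S → ℝ) :
    HasSum (fun t => M.γ ^ t * M.expectAt π t (M.advantage V)) (M.F π - ∑ s, V s * M.ρ s) := by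
  have h1 : ∀ t, M.γ ^ t * M.expectAt π t (M.advantage V) =
      M.γ ^ t * M.expectAt π t (fun z => M.r z.1 z.2) +
        (M.γ ^ (t + 1) * M.expectAt π (t + 1) (fun z => V z.1) -
          M.γ ^ t * M.expectAt π t (fun z => V z.1)) := by
    intro t
    unfold advantage
    rw [M.expectAt_succ_fst hπ, expectAt_sub, expectAt_add, expectAt_const_mul]
    ring
  have hb : ∀ t, |M.expectAt π t (fun z => V z.1)| ≤ ∑ s, |V s| := fun t =>
    M.abs_expectAt_le hπ t fun z =>
      Finset.single_le_sum (f := fun s => |V s|) (fun _ _ => abs_nonneg _) (Finset.mem_univ z.1)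
  have hs := M.summable_geometric_mul hb
  have hs' := (summable_nat_add_iff 1).2 hs
  have h0 : M.expectAt π 0 (fun z => V z.1) = ∑ s, V s * M.ρ s := by
    rw [expectAt_fst]; simp [M.stateProb_zero hπ]
  have htel : HasSum (fun t => M.γ ^ (t + 1) * M.expectAt π (t + 1) (fun z => V z.1) -
      M.γ ^ t * M.expectAt π t (fun z => V z.1)) (-∑ s, V s * M.ρ s) := by
    have := hs'.hasSum.sub hs.hasSum
    rw [hs.tsum_eq_zero_add] at this
    simpa [h0] using this
  simp only [h1, sub_eq_add_neg (M.F π)]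
  exact (M.summable_F hπ).hasSum.add htel

/-- The performance difference identity, for an arbitrary candidate value function `V`. -/
theorem F_sub_eq_sum_occupancy (hπ : IsPolicy π) (V : S → ℝ) :
    M.F π - ∑ s, V s * M.ρ s =
      ∑ s, M.occupancy π s * ∑ a, π s a * M.advantage V (s, a) := by
  refine (M.hasSum_advantage hπ V).unique ?_
  have h1 : ∀ t, M.γ ^ t * M.expectAt π t (M.advantage V) =
      ∑ s, (M.γ ^ t * M.stateProb π t s) * ∑ a, π s a * M.advantage V (s, a) := by
    intro t
    -- Averaging over the action leaves a function of the state alone.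
    rw [M.expectAt_average hπ,
      M.expectAt_fst π t (fun s => ∑ a, π s a * M.advantage V (s, a)), Finset.mul_sum]
    exact Finset.sum_congr rfl fun s _ => by ring
  simp only [h1]
  exact hasSum_sum fun s _ => (M.summable_stateProb hπ s).hasSum.mul_right _

/-- The value function is the fixed point of the Bellman operator of π, a γ-contraction in the sup
norm. Vanishing average advantage is the only property of it used later. -/
theorem exists_value (hπ : IsPolicy π) :
    ∃ V : S → ℝ, ∀ s, ∑ a, π s a * M.advantage V (s, a) = 0 := by
  let B : (S → ℝ) → S → ℝ := fun V s =>
    ∑ a, π s a * (M.r s a + M.γ * ∑ s', M.p s a s' * V s')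
  have hB : ContractingWith ⟨M.γ, M.γ_nonneg⟩ B := by
    refine ⟨by exact_mod_cast M.γ_lt_one, LipschitzWith.of_dist_le_mul fun V W => ?_⟩
    change dist (B V) (B W) ≤ M.γ * dist V W
    refine (dist_pi_le_iff (mul_nonneg M.γ_nonneg dist_nonneg)).2 fun s => ?_
    rw [Real.dist_eq]
    have e : B V s - B W s = ∑ a, π s a * (M.γ * ∑ s', M.p s a s' * (V s' - W s')) := by
      simp only [B]
      rw [← Finset.sum_sub_distrib]
      refine Finset.sum_congr rfl fun a _ => ?_
      simp only [mul_sub, Finset.sum_sub_distrib]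
      ring
    rw [e]
    calc |∑ a, π s a * (M.γ * ∑ s', M.p s a s' * (V s' - W s'))|
        ≤ ∑ a, π s a * (M.γ * dist V W) := by
          refine (Finset.abs_sum_le_sum_abs _ _).trans (Finset.sum_le_sum fun a _ => ?_)
          rw [abs_mul, abs_mul, abs_of_nonneg (hπ.1 s a), abs_of_nonneg M.γ_nonneg]
          refine mul_le_mul_of_nonneg_left (mul_le_mul_of_nonneg_left ?_ M.γ_nonneg) (hπ.1 s a)
          calc |∑ s', M.p s a s' * (V s' - W s')| ≤ ∑ s', M.p s a s' * dist V W := by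
                refine (Finset.abs_sum_le_sum_abs _ _).trans (Finset.sum_le_sum fun s' _ => ?_)
                rw [abs_mul, abs_of_nonneg (M.p_nonneg s a s'), ← Real.dist_eq]
                exact mul_le_mul_of_nonneg_left (dist_le_pi_dist V W s') (M.p_nonneg s a s')
            _ = dist V W := by rw [← Finset.sum_mul, M.p_sum, one_mul]
      _ = M.γ * dist V W := by rw [← Finset.sum_mul, hπ.2, one_mul]
  refine ⟨ContractingWith.fixedPoint B hB, fun s => ?_⟩
  have h := congrFun hB.fixedPoint_isFixedPt s
  simp only [advantage, mul_sub, Finset.sum_sub_distrib, ← Finset.sum_mul, hπ.2, one_mul]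
  exact sub_eq_zero.2 h

theorem mismatch_nonneg (π : S → A → ℝ) : 0 ≤ M.mismatch π := norm_nonneg _

theorem visitation_le_mismatch_mul (π : S → A → ℝ) (s : S) :
    M.visitation π s ≤ M.mismatch π * M.ρ s := by
  rw [← div_le_iff₀ (M.ρ_pos s)]
  exact (le_abs_self _).trans (norm_le_pi_norm (fun s : S => M.visitation π s / M.ρ s) s)

theorem IsOptimal.optValue_eq {M : FiniteMDP S A} {π : S → A → ℝ} (h : M.IsOptimal π) :
    M.optValue = M.F π := by
  refine IsGreatest.csSup_eq ⟨⟨π, h.1, rfl⟩, ?_⟩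
  rintro _ ⟨π', h', rfl⟩
  exact h.2 π' h'

end Paths

end FiniteMDP

/-! ### One-sided second-order bounds and soft-max calculus. -/

/-- Integrating φ'' ≥ −c twice. Ascent needs only this lower side of smoothness, which later allows
a nonnegative square to be dropped. -/
theorem add_sub_half_le_of_neg_le_deriv2 {φ φ' φ'' : ℝ → ℝ} {c : ℝ}
    (h1 : ∀ τ, HasDerivAt φ (φ' τ) τ) (h2 : ∀ τ, HasDerivAt φ' (φ'' τ) τ)
    (hc : ∀ τ, -c ≤ φ'' τ) : φ 0 + φ' 0 - c / 2 ≤ φ 1 := by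
  have hχ : Monotone fun τ => φ' τ + c * τ := by
    have hd : ∀ τ, HasDerivAt (fun τ => φ' τ + c * τ) (φ'' τ + c * 1) τ := fun τ =>
      (h2 τ).add ((hasDerivAt_id τ).const_mul c)
    refine monotone_of_deriv_nonneg (fun τ => (hd τ).differentiableAt) fun τ => ?_
    rw [(hd τ).deriv]
    linarith [hc τ]
  have hd : ∀ τ, HasDerivAt (fun τ => φ τ - φ' 0 * τ + c / 2 * τ ^ 2)
      (φ' τ - φ' 0 * 1 + c / 2 * (2 * τ ^ 1 * 1)) τ := fun τ => by
    exact ((h1 τ).sub ((hasDerivAt_id τ).const_mul (φ' 0))).add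
      (((hasDerivAt_id τ).pow 2).const_mul (c / 2))
  have hm : MonotoneOn (fun τ => φ τ - φ' 0 * τ + c / 2 * τ ^ 2) (Set.Icc 0 1) := by
    refine monotoneOn_of_deriv_nonneg (convex_Icc 0 1)
      (fun τ _ => (hd τ).continuousAt.continuousWithinAt)
      (fun τ _ => (hd τ).differentiableAt.differentiableWithinAt) fun τ hτ => ?_
    rw [(hd τ).deriv]
    rw [interior_Icc] at hτ
    have := hχ hτ.1.le
    simp only [mul_zero, add_zero] at this
    linarith
  have := hm (Set.left_mem_Icc.2 zero_le_one) (Set.right_mem_Icc.2 zero_le_one) zero_le_one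
  simp only [mul_zero, sub_zero, mul_one, one_pow] at this
  linarith

section Softmax

variable {S A : Type*} [Fintype S] [Fintype A]

theorem differentiable_coord (z : S × A) : Differentiable ℝ fun θ : Param S A => θ z :=
  (EuclideanSpace.proj (𝕜 := ℝ) z).differentiable

theorem abs_coord_le_norm (h : Param S A) (z : S × A) : |h z| ≤ ‖h‖ :=
  PiLp.norm_apply_le h z

theorem sum_sq_coord (h : Param S A) : ∑ s, ∑ a, h (s, a) ^ 2 = ‖h‖ ^ 2 := by
  rw [EuclideanSpace.norm_sq_eq, Fintype.sum_prod_type]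
  simp

variable [Nonempty A]

theorem sum_exp_pos (θ : Param S A) (s : S) : 0 < ∑ a, Real.exp (θ (s, a)) :=
  Finset.sum_pos (fun _ _ => Real.exp_pos _) Finset.univ_nonempty

theorem softmaxPolicy_pos (θ : Param S A) (s : S) (a : A) : 0 < softmaxPolicy θ s a :=
  div_pos (Real.exp_pos _) (sum_exp_pos θ s)

theorem sum_softmaxPolicy (θ : Param S A) (s : S) : ∑ a, softmaxPolicy θ s a = 1 := by
  simp only [softmaxPolicy, ← Finset.sum_div]
  exact div_self (sum_exp_pos θ s).ne'

theorem isPolicy_softmaxPolicy (θ : Param S A) : IsPolicy (softmaxPolicy θ) :=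
  ⟨fun s a => (softmaxPolicy_pos θ s a).le, sum_softmaxPolicy θ⟩

theorem softmaxPolicy_le_one (θ : Param S A) (s : S) (a : A) : softmaxPolicy θ s a ≤ 1 := by
  rw [← sum_softmaxPolicy θ s]
  exact Finset.single_le_sum (fun b _ => (softmaxPolicy_pos θ s b).le) (Finset.mem_univ a)

theorem logBarrier_nonpos (θ : Param S A) : logBarrier θ ≤ 0 :=
  mul_nonpos_of_nonneg_of_nonpos (by positivity) (Finset.sum_nonpos fun s _ =>
    Finset.sum_nonpos fun a _ =>
      Real.log_nonpos (softmaxPolicy_pos θ s a).le (softmaxPolicy_le_one θ s a))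

theorem differentiable_softmaxPolicy (s : S) (a : A) :
    Differentiable ℝ fun θ : Param S A => softmaxPolicy θ s a := by
  have h1 : Differentiable ℝ fun θ : Param S A => Real.exp (θ (s, a)) :=
    (differentiable_coord (s, a)).exp
  have h2 : Differentiable ℝ fun θ : Param S A => ∑ a', Real.exp (θ (s, a')) :=
    Differentiable.fun_sum fun a' _ => (differentiable_coord (s, a')).exp
  simp only [softmaxPolicy, div_eq_mul_inv]
  exact Differentiable.mul h1 (Differentiable.inv h2 fun θ => (sum_exp_pos θ s).ne')

theorem differentiable_logBarrier : Differentiable ℝ (logBarrier (S := S) (A := A)) := by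
  unfold logBarrier
  refine Differentiable.const_mul (Differentiable.fun_sum fun s _ =>
    Differentiable.fun_sum fun a _ => ?_) _
  exact (differentiable_softmaxPolicy s a).log fun θ => (softmaxPolicy_pos θ s a).ne'

/-- Mean of the direction `h` over the actions in state `s`, under the soft-max policy. -/
noncomputable def softmaxMean (θ h : Param S A) (s : S) : ℝ :=
  ∑ a, softmaxPolicy θ s a * h (s, a)

/-- Derivative of `log π_θ` at a state-action pair in the direction `h`. -/
noncomputable def softmaxScore (θ h : Param S A) (z : S × A) : ℝ := h z - softmaxMean θ h z.1

/-- Variance of the direction `h` over the actions in state `s`, under the soft-max policy. -/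
noncomputable def softmaxVar (θ h : Param S A) (s : S) : ℝ :=
  ∑ a, softmaxPolicy θ s a * h (s, a) ^ 2 - softmaxMean θ h s ^ 2

theorem abs_softmaxMean_le (θ h : Param S A) (s : S) : |softmaxMean θ h s| ≤ ‖h‖ := by
  calc |softmaxMean θ h s| ≤ ∑ a, softmaxPolicy θ s a * ‖h‖ := by
        refine (Finset.abs_sum_le_sum_abs _ _).trans (Finset.sum_le_sum fun a _ => ?_)
        rw [abs_mul, abs_of_pos (softmaxPolicy_pos θ s a)]
        exact mul_le_mul_of_nonneg_left (abs_coord_le_norm h _) (softmaxPolicy_pos θ s a).le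
    _ = ‖h‖ := by rw [← Finset.sum_mul, sum_softmaxPolicy, one_mul]

theorem abs_softmaxScore_le (θ h : Param S A) (z : S × A) : |softmaxScore θ h z| ≤ 2 * ‖h‖ := by
  have := abs_sub (h z) (softmaxMean θ h z.1)
  rw [softmaxScore]
  linarith [abs_coord_le_norm h z, abs_softmaxMean_le θ h z.1]

theorem softmaxVar_le_sum (θ h : Param S A) (s : S) :
    softmaxVar θ h s ≤ ∑ a, h (s, a) ^ 2 := by
  have : ∑ a, softmaxPolicy θ s a * h (s, a) ^ 2 ≤ ∑ a, h (s, a) ^ 2 :=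
    Finset.sum_le_sum fun a _ => mul_le_of_le_one_left (sq_nonneg _) (softmaxPolicy_le_one θ s a)
  unfold softmaxVar
  linarith [sq_nonneg (softmaxMean θ h s)]

theorem softmaxVar_le (θ h : Param S A) (s : S) : softmaxVar θ h s ≤ ‖h‖ ^ 2 := by
  rw [← sum_sq_coord h]
  refine (softmaxVar_le_sum θ h s).trans ?_
  exact Finset.single_le_sum (f := fun s => ∑ a, h (s, a) ^ 2)
    (fun _ _ => Finset.sum_nonneg fun _ _ => sq_nonneg _) (Finset.mem_univ s)

variable (θ h : Param S A)

theorem hasDerivAt_softmaxPolicy (s : S) (a : A) (τ : ℝ) :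
    HasDerivAt (fun τ : ℝ => softmaxPolicy (θ + τ • h) s a)
      (softmaxPolicy (θ + τ • h) s a * softmaxScore (θ + τ • h) h (s, a)) τ := by
  have hc : ∀ a, HasDerivAt (fun τ : ℝ => Real.exp ((θ + τ • h) (s, a)))
      (Real.exp ((θ + τ • h) (s, a)) * h (s, a)) τ := fun a => by
    have : HasDerivAt (fun τ : ℝ => (θ + τ • h) (s, a)) (h (s, a)) τ := by
      simpa using ((hasDerivAt_id τ).mul_const (h (s, a))).const_add (θ (s, a))
    exact this.exp
  have hsum : HasDerivAt (fun τ : ℝ => ∑ a, Real.exp ((θ + τ • h) (s, a)))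
      (∑ a, Real.exp ((θ + τ • h) (s, a)) * h (s, a)) τ :=
    HasDerivAt.fun_sum fun a _ => hc a
  have hp := sum_exp_pos (θ + τ • h) s
  refine ((hc a).div hsum hp.ne').congr_deriv ?_
  simp only [softmaxPolicy, softmaxScore, softmaxMean, div_mul_eq_mul_div, ← Finset.sum_div]
  field_simp

theorem hasDerivAt_log_softmaxPolicy (s : S) (a : A) (τ : ℝ) :
    HasDerivAt (fun τ : ℝ => Real.log (softmaxPolicy (θ + τ • h) s a))
      (softmaxScore (θ + τ • h) h (s, a)) τ := by
  have hp := (softmaxPolicy_pos (θ + τ • h) s a).ne'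
  refine ((hasDerivAt_softmaxPolicy θ h s a τ).log hp).congr_deriv ?_
  rw [mul_div_cancel_left₀ _ hp]

/-- Only the mean depends on τ, and the derivative of a mean under exponential tilting is the
variance. -/
theorem hasDerivAt_softmaxScore (z : S × A) (τ : ℝ) :
    HasDerivAt (fun τ : ℝ => softmaxScore (θ + τ • h) h z)
      (-softmaxVar (θ + τ • h) h z.1) τ := by
  have : HasDerivAt (fun τ : ℝ => softmaxMean (θ + τ • h) h z.1)
      (∑ a, softmaxPolicy (θ + τ • h) z.1 a * softmaxScore (θ + τ • h) h (z.1, a) * h (z.1, a))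
      τ := HasDerivAt.fun_sum fun a _ => (hasDerivAt_softmaxPolicy θ h z.1 a τ).mul_const _
  refine (this.const_sub (h z)).congr_deriv ?_
  congr 1
  have e : ∀ a, softmaxPolicy (θ + τ • h) z.1 a * softmaxScore (θ + τ • h) h (z.1, a) *
      h (z.1, a) = softmaxPolicy (θ + τ • h) z.1 a * h (z.1, a) ^ 2 -
        softmaxPolicy (θ + τ • h) z.1 a * h (z.1, a) * softmaxMean (θ + τ • h) h z.1 := by
    intro a; simp only [softmaxScore]; ring
  simp only [e, Finset.sum_sub_distrib, ← Finset.sum_mul]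
  rw [softmaxVar, sq (softmaxMean _ _ _)]
  rfl

namespace FiniteMDP

variable (M : FiniteMDP S A)

/-- Likelihood-ratio formula: ρ and the transition probabilities do not depend on θ, so the
logarithmic derivative of a path probability is the sum of the scores along the path. -/
theorem hasDerivAt_pathProb {t : ℕ} (x : Fin (t + 1) → S × A) (τ : ℝ) :
    HasDerivAt (fun τ : ℝ => M.pathProb (softmaxPolicy (θ + τ • h)) x)
      (M.pathProb (softmaxPolicy (θ + τ • h)) x * ∑ i, softmaxScore (θ + τ • h) h (x i)) τ := by
  induction t with
  | zero =>
    simp only [pathProb, Finset.univ_eq_empty, Finset.prod_empty, mul_one,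
      Nat.reduceAdd, Finset.univ_unique, Fin.default_eq_zero, Finset.sum_singleton]
    refine ((hasDerivAt_softmaxPolicy θ h (x 0).1 (x 0).2 τ).const_mul
      (M.ρ (x 0).1)).congr_deriv ?_
    ring
  | succ t ih =>
    obtain ⟨y, z, rfl⟩ : ∃ (y : Fin (t + 1) → S × A) (z : S × A),
        x = (Fin.snoc y z : Fin (t + 2) → S × A) :=
      ⟨Fin.init (α := fun _ => S × A) x, x (Fin.last _),
        (Fin.snoc_init_self (α := fun _ => S × A) x).symm⟩
    rw [Fin.sum_univ_castSucc]
    simp only [pathProb_snoc, Fin.snoc_castSucc (α := fun _ => S × A),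
      Fin.snoc_last (α := fun _ => S × A)]
    refine ((ih y).mul ((hasDerivAt_softmaxPolicy θ h z.1 z.2 τ).const_mul
      (M.p (y (Fin.last t)).1 (y (Fin.last t)).2 z.1))).congr_deriv ?_
    ring

theorem differentiable_pathProb {t : ℕ} (x : Fin (t + 1) → S × A) :
    Differentiable ℝ fun θ : Param S A => M.pathProb (softmaxPolicy θ) x := by
  unfold pathProb
  have h1 : Differentiable ℝ fun θ : Param S A => M.ρ (x 0).1 * softmaxPolicy θ (x 0).1 (x 0).2 :=
    (differentiable_softmaxPolicy (x 0).1 (x 0).2).const_mul _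
  have h2 : ∀ i : Fin t, Differentiable ℝ fun θ : Param S A =>
      M.p (x i.castSucc).1 (x i.castSucc).2 (x i.succ).1 *
        softmaxPolicy θ (x i.succ).1 (x i.succ).2 :=
    fun i => (differentiable_softmaxPolicy (x i.succ).1 (x i.succ).2).const_mul _
  exact Differentiable.mul h1 fun θ =>
    (HasFDerivAt.finsetProd fun i _ => (h2 i θ).hasFDerivAt).differentiableAt

theorem differentiable_expectAt (t : ℕ) (f : S × A → ℝ) :
    Differentiable ℝ fun θ : Param S A => M.expectAt (softmaxPolicy θ) t f :=
  Differentiable.fun_sum fun x _ => (M.differentiable_pathProb x).mul_const _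

theorem hasDerivAt_expectAt (t : ℕ) (f : S × A → ℝ) (τ : ℝ) :
    HasDerivAt (fun τ : ℝ => M.expectAt (softmaxPolicy (θ + τ • h)) t f)
      (∑ x : Fin (t + 1) → S × A, M.pathProb (softmaxPolicy (θ + τ • h)) x *
        (∑ i, softmaxScore (θ + τ • h) h (x i)) * f (x (Fin.last t))) τ :=
  HasDerivAt.fun_sum fun x _ => (M.hasDerivAt_pathProb θ h x τ).mul_const _

theorem hasDerivAt_line {G : Param S A → ℝ} (hG : DifferentiableAt ℝ G θ) :
    HasDerivAt (fun τ : ℝ => G (θ + τ • h)) (fderiv ℝ G θ h) 0 := by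
  have hl : HasDerivAt (fun τ : ℝ => θ + τ • h) h 0 := by
    simpa using ((hasDerivAt_id (0 : ℝ)).smul_const h).const_add θ
  have hG' : HasFDerivAt G (fderiv ℝ G θ) (θ + (0 : ℝ) • h) := by
    simpa using hG.hasFDerivAt
  exact hG'.comp_hasDerivAt (0 : ℝ) hl

theorem fderiv_expectAt (t : ℕ) (f : S × A → ℝ) :
    fderiv ℝ (fun θ : Param S A => M.expectAt (softmaxPolicy θ) t f) θ h =
      ∑ x : Fin (t + 1) → S × A, M.pathProb (softmaxPolicy θ) x *
        (∑ i, softmaxScore θ h (x i)) * f (x (Fin.last t)) := by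
  have := (hasDerivAt_line θ h ((M.differentiable_expectAt t f) θ)).unique
    (M.hasDerivAt_expectAt θ h t f 0)
  simpa using this

theorem norm_fderiv_expectAt_le (t : ℕ) {f : S × A → ℝ} (hf : ∀ z, |f z| ≤ 1) :
    ‖fderiv ℝ (fun θ : Param S A => M.expectAt (softmaxPolicy θ) t f) θ‖ ≤ 2 * (t + 1) := by
  refine ContinuousLinearMap.opNorm_le_bound _ (by positivity) fun h => ?_
  rw [fderiv_expectAt, Real.norm_eq_abs]
  have hπ := isPolicy_softmaxPolicy θ
  calc |∑ x : Fin (t + 1) → S × A, M.pathProb (softmaxPolicy θ) x *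
        (∑ i, softmaxScore θ h (x i)) * f (x (Fin.last t))|
      ≤ ∑ x : Fin (t + 1) → S × A, M.pathProb (softmaxPolicy θ) x * (2 * (t + 1) * ‖h‖) := by
        refine (Finset.abs_sum_le_sum_abs _ _).trans (Finset.sum_le_sum fun x _ => ?_)
        rw [mul_assoc, abs_mul, abs_of_nonneg (M.pathProb_nonneg hπ x), abs_mul]
        refine mul_le_mul_of_nonneg_left ?_ (M.pathProb_nonneg hπ x)
        have h1 : |∑ i, softmaxScore θ h (x i)| ≤ 2 * (t + 1) * ‖h‖ := by
          refine (Finset.abs_sum_le_sum_abs _ _).trans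
            ((Finset.sum_le_sum fun i _ => abs_softmaxScore_le θ h (x i)).trans (le_of_eq ?_))
          simp; ring
        calc _ ≤ |∑ i, softmaxScore θ h (x i)| * 1 :=
              mul_le_mul_of_nonneg_left (hf _) (abs_nonneg _)
          _ ≤ _ := by rwa [mul_one]
    _ = 2 * (t + 1) * ‖h‖ := by rw [← Finset.sum_mul, M.sum_pathProb hπ, one_mul]

/-- Along the segment the second derivative is E[((∑ score)² − ∑ Var) f]. The square is nonnegative,
each variance is at most ‖h‖² and f lies in [0,1], so −(t+1)‖h‖² is a lower bound. Linear growth in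
t yields the constant 1/(1−γ)² after discounting. -/
theorem expectAt_add_ge (t : ℕ) {f : S × A → ℝ} (hf0 : ∀ z, 0 ≤ f z) (hf1 : ∀ z, f z ≤ 1) :
    M.expectAt (softmaxPolicy θ) t f +
        fderiv ℝ (fun θ : Param S A => M.expectAt (softmaxPolicy θ) t f) θ h -
        (t + 1) * ‖h‖ ^ 2 / 2 ≤
      M.expectAt (softmaxPolicy (θ + h)) t f := by
  have h2 : ∀ τ : ℝ, HasDerivAt (fun τ : ℝ => ∑ x : Fin (t + 1) → S × A,
      M.pathProb (softmaxPolicy (θ + τ • h)) x *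
        (∑ i, softmaxScore (θ + τ • h) h (x i)) * f (x (Fin.last t)))
      (∑ x : Fin (t + 1) → S × A, M.pathProb (softmaxPolicy (θ + τ • h)) x *
        ((∑ i, softmaxScore (θ + τ • h) h (x i)) ^ 2 -
          ∑ i, softmaxVar (θ + τ • h) h (x i).1) * f (x (Fin.last t))) τ := by
    intro τ
    refine HasDerivAt.fun_sum fun x _ => ?_
    refine (((M.hasDerivAt_pathProb θ h x τ).mul (HasDerivAt.fun_sum fun i _ =>
      hasDerivAt_softmaxScore θ h (x i) τ)).mul_const _).congr_deriv ?_
    rw [Finset.sum_neg_distrib]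
    ring
  have := add_sub_half_le_of_neg_le_deriv2 (c := (t + 1) * ‖h‖ ^ 2)
    (M.hasDerivAt_expectAt θ h t f) h2 fun τ => ?_
  · rw [fderiv_expectAt]
    simpa using this
  · have hπ := isPolicy_softmaxPolicy (θ + τ • h)
    calc -((t + 1) * ‖h‖ ^ 2) = ∑ x : Fin (t + 1) → S × A,
          M.pathProb (softmaxPolicy (θ + τ • h)) x * (-((t + 1) * ‖h‖ ^ 2)) := by
          rw [← Finset.sum_mul, M.sum_pathProb hπ, one_mul]
      _ ≤ _ := by
          refine Finset.sum_le_sum fun x _ => ?_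
          rw [mul_assoc]
          refine mul_le_mul_of_nonneg_left ?_ (M.pathProb_nonneg hπ x)
          have hv : ∑ i, softmaxVar (θ + τ • h) h (x i).1 ≤ (t + 1) * ‖h‖ ^ 2 := by
            refine (Finset.sum_le_sum fun i _ => softmaxVar_le _ h (x i).1).trans (le_of_eq ?_)
            simp
          have hn : 0 ≤ (t + 1) * ‖h‖ ^ 2 := by positivity
          have h1 : -((t + 1) * ‖h‖ ^ 2) ≤ (∑ i, softmaxScore (θ + τ • h) h (x i)) ^ 2 -
              ∑ i, softmaxVar (θ + τ • h) h (x i).1 := by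
            linarith [sq_nonneg (∑ i, softmaxScore (θ + τ • h) h (x i))]
          nlinarith [hf0 (x (Fin.last t)), hf1 (x (Fin.last t))]

theorem hasSum_succ_mul_geometric :
    HasSum (fun t : ℕ => M.γ ^ t * ((t : ℝ) + 1)) (1 / (1 - M.γ) ^ 2) := by
  have hn : ‖M.γ‖ < 1 := by
    rw [Real.norm_eq_abs, abs_of_nonneg M.γ_nonneg]; exact M.γ_lt_one
  have h := (hasSum_coe_mul_geometric_of_norm_lt_one hn).add
    (hasSum_geometric_of_lt_one M.γ_nonneg M.γ_lt_one)
  have hp := M.one_sub_γ_pos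
  have e : 1 / (1 - M.γ) ^ 2 = M.γ / (1 - M.γ) ^ 2 + (1 - M.γ)⁻¹ := by
    field_simp
    ring
  rw [e]
  exact h.congr_fun fun t => by ring

/-- The discounted value of the reward function `f` under the soft-max policy. -/
noncomputable def softmaxValue (f : S × A → ℝ) (θ : Param S A) : ℝ :=
  ∑' t : ℕ, M.γ ^ t * M.expectAt (softmaxPolicy θ) t f

variable {f : S × A → ℝ}

theorem summable_softmaxValue (hf : ∀ z, |f z| ≤ 1) :
    Summable fun t : ℕ => M.γ ^ t * M.expectAt (softmaxPolicy θ) t f :=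
  M.summable_geometric_mul fun t => M.abs_expectAt_le (isPolicy_softmaxPolicy θ) t hf

theorem norm_smul_fderiv_expectAt_le (hf : ∀ z, |f z| ≤ 1) (t : ℕ) :
    ‖M.γ ^ t • fderiv ℝ (fun θ : Param S A => M.expectAt (softmaxPolicy θ) t f) θ‖ ≤
      2 * (M.γ ^ t * ((t : ℝ) + 1)) := by
  rw [norm_smul, Real.norm_eq_abs, abs_of_nonneg (pow_nonneg M.γ_nonneg t)]
  nlinarith [mul_le_mul_of_nonneg_left (M.norm_fderiv_expectAt_le θ t hf)
    (pow_nonneg M.γ_nonneg t)]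

/-- Termwise differentiation, dominated by 2(t+1)γ^t uniformly in θ. A general f is allowed because
the reward gives F, while the indicator of a state gives the occupancy. -/
theorem hasFDerivAt_softmaxValue (hf : ∀ z, |f z| ≤ 1) :
    HasFDerivAt (M.softmaxValue f)
      (∑' t : ℕ, M.γ ^ t • fderiv ℝ (fun θ : Param S A => M.expectAt (softmaxPolicy θ) t f) θ)
      θ := by
  refine hasFDerivAt_tsum (𝕜 := ℝ)
    (f := fun (t : ℕ) (θ : Param S A) => M.γ ^ t * M.expectAt (softmaxPolicy θ) t f)
    (f' := fun (t : ℕ) (θ : Param S A) =>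
      M.γ ^ t • fderiv ℝ (fun θ : Param S A => M.expectAt (softmaxPolicy θ) t f) θ)
    (M.hasSum_succ_mul_geometric.summable.mul_left 2) (x₀ := θ)
    (fun t x => ?_) (fun t x => M.norm_smul_fderiv_expectAt_le x hf t)
    (M.summable_softmaxValue θ hf) θ
  exact ((M.differentiable_expectAt t f) x).hasFDerivAt.const_mul (M.γ ^ t)

theorem differentiable_softmaxValue (hf : ∀ z, |f z| ≤ 1) :
    Differentiable ℝ (M.softmaxValue f) :=
  fun θ => (M.hasFDerivAt_softmaxValue θ hf).differentiableAt

theorem norm_fderiv_softmaxValue_le (hf : ∀ z, |f z| ≤ 1) :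
    ‖fderiv ℝ (M.softmaxValue f) θ‖ ≤ 2 / (1 - M.γ) ^ 2 := by
  rw [(M.hasFDerivAt_softmaxValue θ hf).fderiv]
  have := M.hasSum_succ_mul_geometric.mul_left 2
  refine (tsum_of_norm_bounded this (M.norm_smul_fderiv_expectAt_le θ hf)).trans (le_of_eq ?_)
  ring

theorem softmaxValue_add_ge (hf0 : ∀ z, 0 ≤ f z) (hf1 : ∀ z, f z ≤ 1) :
    M.softmaxValue f θ + fderiv ℝ (M.softmaxValue f) θ h - ‖h‖ ^ 2 / (2 * (1 - M.γ) ^ 2) ≤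
      M.softmaxValue f (θ + h) := by
  have hf : ∀ z, |f z| ≤ 1 := fun z => by rw [abs_of_nonneg (hf0 z)]; exact hf1 z
  have hs : Summable fun t : ℕ =>
      M.γ ^ t • fderiv ℝ (fun θ : Param S A => M.expectAt (softmaxPolicy θ) t f) θ :=
    Summable.of_norm_bounded (M.hasSum_succ_mul_geometric.summable.mul_left 2)
      (M.norm_smul_fderiv_expectAt_le θ hf)
  have hd : HasSum (fun t : ℕ => M.γ ^ t *
      fderiv ℝ (fun θ : Param S A => M.expectAt (softmaxPolicy θ) t f) θ h)
      (fderiv ℝ (M.softmaxValue f) θ h) := by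
    rw [(M.hasFDerivAt_softmaxValue θ hf).fderiv]
    simpa using (ContinuousLinearMap.apply ℝ ℝ h).hasSum hs.hasSum
  have e : ‖h‖ ^ 2 / (2 * (1 - M.γ) ^ 2) = ‖h‖ ^ 2 / 2 * (1 / (1 - M.γ) ^ 2) := by
    have := M.one_sub_γ_pos
    field_simp
  rw [e]
  refine hasSum_le (fun t => ?_) (((M.summable_softmaxValue θ hf).hasSum.add hd).sub
    (M.hasSum_succ_mul_geometric.mul_left (‖h‖ ^ 2 / 2)))
    (M.summable_softmaxValue (θ + h) hf).hasSum
  have := mul_le_mul_of_nonneg_left (M.expectAt_add_ge θ h t hf0 hf1)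
    (pow_nonneg M.γ_nonneg t)
  linarith

end FiniteMDP

end Softmax

/-! ### The regularized objective: smoothness and gradient domination. -/

section Objective

variable {S A : Type*} [Fintype S] [Fintype A] [Nonempty A] (θ h : Param S A)

theorem hasDerivAt_logBarrier (τ : ℝ) :
    HasDerivAt (fun τ : ℝ => logBarrier (θ + τ • h))
      (1 / ((Fintype.card S : ℝ) * Fintype.card A) *
        ∑ s, ∑ a, softmaxScore (θ + τ • h) h (s, a)) τ :=
  (HasDerivAt.fun_sum fun s _ => HasDerivAt.fun_sum fun a _ =>
    hasDerivAt_log_softmaxPolicy θ h s a τ).const_mul _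

theorem fderiv_logBarrier :
    fderiv ℝ (logBarrier (S := S) (A := A)) θ h =
      1 / ((Fintype.card S : ℝ) * Fintype.card A) * ∑ s, ∑ a, softmaxScore θ h (s, a) := by
  have := (FiniteMDP.hasDerivAt_line θ h (differentiable_logBarrier θ)).unique
    (hasDerivAt_logBarrier θ h 0)
  simpa using this

variable [Nonempty S]

theorem norm_fderiv_logBarrier_le : ‖fderiv ℝ (logBarrier (S := S) (A := A)) θ‖ ≤ 2 := by
  refine ContinuousLinearMap.opNorm_le_bound _ (by norm_num) fun h => ?_
  rw [fderiv_logBarrier, Real.norm_eq_abs, abs_mul, abs_of_nonneg (by positivity)]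
  have hS : (0 : ℝ) < Fintype.card S := by exact_mod_cast Fintype.card_pos
  have hA : (0 : ℝ) < Fintype.card A := by exact_mod_cast Fintype.card_pos
  rw [one_div, ← div_eq_inv_mul, div_le_iff₀ (by positivity), ← Fintype.sum_prod_type']
  refine (Finset.abs_sum_le_sum_abs _ _).trans
    ((Finset.sum_le_sum fun z _ => abs_softmaxScore_le θ h z).trans (le_of_eq ?_))
  simp
  ring

/-- The variance of each state occurs once per action, which cancels A in the normalization.
Different states involve disjoint coordinates of h, so the variances add up to at most ‖h‖². -/
theorem logBarrier_add_ge :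
    logBarrier θ + fderiv ℝ (logBarrier (S := S) (A := A)) θ h -
      ‖h‖ ^ 2 / Fintype.card S / 2 ≤ logBarrier (θ + h) := by
  have hS : (0 : ℝ) < Fintype.card S := by exact_mod_cast Fintype.card_pos
  have hA : (0 : ℝ) < Fintype.card A := by exact_mod_cast Fintype.card_pos
  have h2 : ∀ τ : ℝ, HasDerivAt (fun τ : ℝ => 1 / ((Fintype.card S : ℝ) * Fintype.card A) *
        ∑ s, ∑ a, softmaxScore (θ + τ • h) h (s, a))
      (1 / ((Fintype.card S : ℝ) * Fintype.card A) *
        ∑ s, ∑ _a : A, -softmaxVar (θ + τ • h) h s) τ := fun τ =>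
    (HasDerivAt.fun_sum fun s _ => HasDerivAt.fun_sum fun a _ =>
      hasDerivAt_softmaxScore θ h (s, a) τ).const_mul _
  have := add_sub_half_le_of_neg_le_deriv2 (c := ‖h‖ ^ 2 / Fintype.card S)
    (hasDerivAt_logBarrier θ h) h2 fun τ => ?_
  · rw [fderiv_logBarrier]
    simpa using this
  · have hv : ∑ s, softmaxVar (θ + τ • h) h s ≤ ‖h‖ ^ 2 := by
      rw [← sum_sq_coord h]
      exact Finset.sum_le_sum fun s _ => softmaxVar_le_sum _ h s
    simp only [Finset.sum_const, Finset.card_univ, smul_neg, Finset.sum_neg_distrib, nsmul_eq_mul,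
      ← Finset.mul_sum]
    rw [show 1 / ((Fintype.card S : ℝ) * Fintype.card A) *
      -(Fintype.card A * ∑ s, softmaxVar (θ + τ • h) h s) =
        -((∑ s, softmaxVar (θ + τ • h) h s) / Fintype.card S) by field_simp]
    exact neg_le_neg (div_le_div_of_nonneg_right hv hS.le)

namespace FiniteMDP

variable (M : FiniteMDP S A)

theorem abs_r_le (z : S × A) : |M.r z.1 z.2| ≤ 1 := by
  rw [abs_of_nonneg (M.r_nonneg _ _)]; exact M.r_le_one _ _

theorem differentiable_F_softmaxPolicy :
    Differentiable ℝ fun θ : Param S A => M.F (softmaxPolicy θ) :=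
  M.differentiable_softmaxValue M.abs_r_le

theorem inner_gradient_eq (G : Param S A → ℝ) :
    inner ℝ (gradient G θ) h = fderiv ℝ G θ h := by
  rw [gradient, InnerProductSpace.toDual_symm_apply]

theorem fderiv_regObjective (lam : ℝ) :
    fderiv ℝ (M.regObjective lam) θ =
      fderiv ℝ (fun θ : Param S A => M.F (softmaxPolicy θ)) θ +
        lam • fderiv ℝ (logBarrier (S := S) (A := A)) θ :=
  ((M.differentiable_F_softmaxPolicy θ).hasFDerivAt.add
    ((differentiable_logBarrier θ).hasFDerivAt.const_mul lam)).fderiv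

theorem norm_gradient_regObjective_le {lam : ℝ} (hlam : 0 ≤ lam) :
    ‖gradient (M.regObjective lam) θ‖ ≤ 2 * (1 / (1 - M.γ) ^ 2 + lam) := by
  rw [gradient, LinearIsometryEquiv.norm_map, fderiv_regObjective]
  have h1 : ‖fderiv ℝ (fun θ : Param S A => M.F (softmaxPolicy θ)) θ‖ ≤ 2 / (1 - M.γ) ^ 2 :=
    M.norm_fderiv_softmaxValue_le θ M.abs_r_le
  have h2 := norm_add_le (fderiv ℝ (fun θ : Param S A => M.F (softmaxPolicy θ)) θ)
    (lam • fderiv ℝ (logBarrier (S := S) (A := A)) θ)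
  rw [norm_smul, Real.norm_eq_abs, abs_of_nonneg hlam] at h2
  have h3 := mul_le_mul_of_nonneg_left (norm_fderiv_logBarrier_le θ) hlam
  calc _ ≤ 2 / (1 - M.γ) ^ 2 + lam * 2 := h2.trans (add_le_add h1 h3)
    _ = _ := by ring

theorem smoothConst_pos {lam : ℝ} (hlam : 0 ≤ lam) : 0 < M.smoothConst lam := by
  have := M.one_sub_γ_pos
  unfold smoothConst
  positivity

theorem regObjective_add_ge {lam : ℝ} (hlam : 0 ≤ lam) :
    M.regObjective lam θ + inner ℝ (gradient (M.regObjective lam) θ) h -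
      M.smoothConst lam / 2 * ‖h‖ ^ 2 ≤ M.regObjective lam (θ + h) := by
  have h1 : M.F (softmaxPolicy θ) + fderiv ℝ (fun θ : Param S A => M.F (softmaxPolicy θ)) θ h -
      ‖h‖ ^ 2 / (2 * (1 - M.γ) ^ 2) ≤ M.F (softmaxPolicy (θ + h)) :=
    M.softmaxValue_add_ge θ h (fun _ => M.r_nonneg _ _) (fun _ => M.r_le_one _ _)
  have h2 := mul_le_mul_of_nonneg_left (logBarrier_add_ge θ h) hlam
  rw [inner_gradient_eq, fderiv_regObjective]
  simp only [regObjective, add_apply, smul_apply,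
    smul_eq_mul]
  have hp := M.one_sub_γ_pos
  have hp1 : 1 - M.γ ≤ 1 := by linarith [M.γ_nonneg]
  have h3 : ‖h‖ ^ 2 / (2 * (1 - M.γ) ^ 2) + lam * (‖h‖ ^ 2 / Fintype.card S / 2) ≤
      M.smoothConst lam / 2 * ‖h‖ ^ 2 := by
    have hS : (0 : ℝ) < Fintype.card S := by exact_mod_cast Fintype.card_pos
    -- The one-sided constants 1/(1−γ)² and λ/S lie below the two summands of β_λ.
    have e1 : 1 / (1 - M.γ) ^ 2 ≤ 8 / (1 - M.γ) ^ 3 := by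
      rw [div_le_div_iff₀ (by positivity) (by positivity)]
      nlinarith [sq_nonneg (1 - M.γ), pow_pos hp 2]
    have e2 : lam / Fintype.card S ≤ 2 * lam / Fintype.card S := by
      gcongr; linarith
    calc _ = (1 / (1 - M.γ) ^ 2 + lam / Fintype.card S) / 2 * ‖h‖ ^ 2 := by
          field_simp
      _ ≤ _ := by
          unfold smoothConst
          gcongr
  linarith

/-- The policy gradient formula for soft-max policies. -/
theorem fderiv_F_softmaxPolicy {V : S → ℝ}
    (hV : ∀ s, ∑ a, softmaxPolicy θ s a * M.advantage V (s, a) = 0) :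
    fderiv ℝ (fun θ : Param S A => M.F (softmaxPolicy θ)) θ h =
      ∑ s, M.occupancy (softmaxPolicy θ) s *
        ∑ a, softmaxPolicy θ s a * h (s, a) * M.advantage V (s, a) := by
  classical
  have hocc : ∀ s, Differentiable ℝ fun θ : Param S A => M.occupancy (softmaxPolicy θ) s :=
    fun s => M.differentiable_softmaxValue fun z => by split_ifs <;> simp
  -- V stays frozen at the base point, so along the line only the occupancy and the policy vary.
  have hF : (fun τ : ℝ => M.F (softmaxPolicy (θ + τ • h))) = fun τ : ℝ =>
      ∑ s, M.occupancy (softmaxPolicy (θ + τ • h)) s *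
        ∑ a, softmaxPolicy (θ + τ • h) s a * M.advantage V (s, a) + ∑ s, V s * M.ρ s := by
    ext τ
    rw [← M.F_sub_eq_sum_occupancy (isPolicy_softmaxPolicy _)]
    ring
  have h1 := hasDerivAt_line θ h (M.differentiable_F_softmaxPolicy θ)
  rw [hF] at h1
  have h2 := (HasDerivAt.fun_sum (u := Finset.univ) fun s _ =>
    (hasDerivAt_line θ h (hocc s θ)).fun_mul
      (HasDerivAt.fun_sum (u := Finset.univ) fun a _ =>
        (hasDerivAt_softmaxPolicy θ h s a 0).mul_const (M.advantage V (s, a)))).add_const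
      (∑ s, V s * M.ρ s)
  rw [h1.unique h2]
  refine Finset.sum_congr rfl fun s _ => ?_
  -- At τ = 0 the derivative of the occupancy multiplies an average advantage that vanishes by `hV`.
  -- The mean inside the score drops out below for the same reason.
  simp only [zero_smul, add_zero, hV, mul_zero, zero_add]
  congr 1
  have e : ∀ a, softmaxPolicy θ s a * softmaxScore θ h (s, a) * M.advantage V (s, a) =
      softmaxPolicy θ s a * h (s, a) * M.advantage V (s, a) -
        softmaxMean θ h s * (softmaxPolicy θ s a * M.advantage V (s, a)) := by
    intro a; simp only [softmaxScore]; ring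
  simp only [e, Finset.sum_sub_distrib, ← Finset.mul_sum, hV, mul_zero, sub_zero]

/-- With d the occupancy, the partial derivative in the coordinate (s,a) is d·π·Adv + λ/(SA) −
(λ/S)π, and the hypothesis keeps it below λ/(2SA). Hence d·π·Adv ≤ (λ/S)π. Both sides carry the
factor π > 0, so no lower bound on the policy is needed; finally ρ ≤ d. -/
theorem ρ_mul_advantage_le {lam : ℝ} (hlam : 0 ≤ lam)
    (hg : ‖gradient (M.regObjective lam) θ‖ ≤
      lam / (2 * ((Fintype.card S : ℝ) * Fintype.card A))) {V : S → ℝ}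
    (hV : ∀ s, ∑ a, softmaxPolicy θ s a * M.advantage V (s, a) = 0) (s : S) (a : A) :
    M.ρ s * M.advantage V (s, a) ≤ lam / Fintype.card S := by
  classical
  have hS : (0 : ℝ) < Fintype.card S := by exact_mod_cast Fintype.card_pos
  have hA : (0 : ℝ) < Fintype.card A := by exact_mod_cast Fintype.card_pos
  rcases le_or_gt (M.advantage V (s, a)) 0 with hneg | hpos
  · exact (mul_nonpos_of_nonneg_of_nonpos (M.ρ_pos s).le hneg).trans (by positivity)
  set e : Param S A := EuclideanSpace.single (s, a) 1 with he
  have hπ := softmaxPolicy_pos θ s a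
  have h1 : fderiv ℝ (fun θ : Param S A => M.F (softmaxPolicy θ)) θ e =
      M.occupancy (softmaxPolicy θ) s * (softmaxPolicy θ s a * M.advantage V (s, a)) := by
    rw [M.fderiv_F_softmaxPolicy θ e hV, Finset.sum_eq_single s, Finset.sum_eq_single a]
    · simp [he]
    · intro b _ hb; simp [he, hb]
    · simp
    · intro b _ hb; simp [he, hb]
    · simp
  have h2 : ∑ s', ∑ a', softmaxScore θ e (s', a') = 1 - Fintype.card A * softmaxPolicy θ s a := by
    have hm : ∀ s', softmaxMean θ e s' = if s' = s then softmaxPolicy θ s a else 0 := by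
      intro s'
      by_cases hs : s' = s
      · subst hs
        simp [softmaxMean, he]
      · simp [softmaxMean, he, hs]
    simp only [softmaxScore, hm, Finset.sum_sub_distrib]
    congr 1
    · rw [← Fintype.sum_prod_type']
      simp [he]
    · simp [Finset.sum_ite_eq']
  have h3 : fderiv ℝ (M.regObjective lam) θ e ≤
      lam / (2 * ((Fintype.card S : ℝ) * Fintype.card A)) := by
    rw [← inner_gradient_eq]
    refine (real_inner_le_norm _ _).trans ?_
    simpa [he] using hg
  rw [fderiv_regObjective, add_apply, smul_apply, h1,
    fderiv_logBarrier, h2, smul_eq_mul] at h3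
  have h4 : lam * (1 / ((Fintype.card S : ℝ) * Fintype.card A) *
      (1 - Fintype.card A * softmaxPolicy θ s a)) =
      2 * (lam / (2 * ((Fintype.card S : ℝ) * Fintype.card A))) -
        lam / Fintype.card S * softmaxPolicy θ s a := by
    field_simp
  have h5 : 0 ≤ lam / (2 * ((Fintype.card S : ℝ) * Fintype.card A)) := by positivity
  have h6 : M.occupancy (softmaxPolicy θ) s * M.advantage V (s, a) ≤ lam / Fintype.card S := by
    refine le_of_mul_le_mul_right ?_ hπ
    linarith
  exact (mul_le_mul_of_nonneg_right (M.ρ_le_occupancy (isPolicy_softmaxPolicy θ) s)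
    hpos.le).trans h6

/-- Approximate stationary points of the regularized objective are nearly optimal. -/
theorem F_sub_le_of_norm_gradient_le {lam : ℝ} (hlam : 0 ≤ lam)
    (hg : ‖gradient (M.regObjective lam) θ‖ ≤
      lam / (2 * ((Fintype.card S : ℝ) * Fintype.card A)))
    {π : S → A → ℝ} (hπ : IsPolicy π) :
    M.F π - M.F (softmaxPolicy θ) ≤ lam / (1 - M.γ) * M.mismatch π := by
  have hS : (0 : ℝ) < Fintype.card S := by exact_mod_cast Fintype.card_pos
  have hp := M.one_sub_γ_pos
  obtain ⟨V, hV⟩ := M.exists_value (isPolicy_softmaxPolicy θ)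
  have h1 := M.F_sub_eq_sum_occupancy (isPolicy_softmaxPolicy θ) V
  simp only [hV, mul_zero, Finset.sum_const_zero] at h1
  have h2 := M.F_sub_eq_sum_occupancy hπ V
  rw [show M.F π - M.F (softmaxPolicy θ) = M.F π - ∑ s, V s * M.ρ s by linarith, h2]
  -- In each state ρ(s) cancels between the bounds on occupancy and on advantage, leaving S equal
  -- terms.
  calc ∑ s, M.occupancy π s * ∑ a, π s a * M.advantage V (s, a)
      ≤ ∑ _s : S, M.mismatch π / (1 - M.γ) * (lam / Fintype.card S) := by
        refine Finset.sum_le_sum fun s _ => ?_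
        have hρ := M.ρ_pos s
        have ho : M.occupancy π s ≤ M.mismatch π / (1 - M.γ) * M.ρ s := by
          have := M.visitation_le_mismatch_mul π s
          rw [visitation_eq] at this
          rw [div_mul_eq_mul_div, le_div_iff₀ hp]
          linarith
        have ha : ∑ a, π s a * M.advantage V (s, a) ≤ lam / Fintype.card S / M.ρ s := by
          calc _ ≤ ∑ a, π s a * (lam / Fintype.card S / M.ρ s) := by
                refine Finset.sum_le_sum fun a _ => mul_le_mul_of_nonneg_left ?_ (hπ.1 s a)
                rw [le_div_iff₀ hρ, mul_comm]
                exact M.ρ_mul_advantage_le θ hlam hg hV s a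
            _ = _ := by rw [← Finset.sum_mul, hπ.2, one_mul]
        calc _ ≤ M.occupancy π s * (lam / Fintype.card S / M.ρ s) :=
              mul_le_mul_of_nonneg_left ha (M.occupancy_pos hπ s).le
          _ ≤ M.mismatch π / (1 - M.γ) * M.ρ s * (lam / Fintype.card S / M.ρ s) :=
              mul_le_mul_of_nonneg_right ho (by positivity)
          _ = _ := by field_simp
    _ = lam / (1 - M.γ) * M.mismatch π := by
        simp only [Finset.sum_const, Finset.card_univ, nsmul_eq_mul]
        field_simp

theorem regObjective_le_F {lam : ℝ} (hlam : 0 ≤ lam) :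
    M.regObjective lam θ ≤ M.F (softmaxPolicy θ) :=
  add_le_of_nonpos_right (mul_nonpos_of_nonneg_of_nonpos hlam (logBarrier_nonpos θ))

end FiniteMDP

end Objective

/-! ### A maximal Azuma–Hoeffding inequality. -/

section Azuma

variable {Ω : Type*} {m0 : MeasurableSpace Ω} {μ : Measure Ω} [IsProbabilityMeasure μ]
  {𝒢 : Filtration ℕ m0} {ξ : ℕ → Ω → ℝ} {c : ℕ → ℝ}

theorem stronglyMeasurable_sum_range (hm : ∀ k, StronglyMeasurable[𝒢 (k + 1)] (ξ k)) (k : ℕ) :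
    StronglyMeasurable[𝒢 k] fun ω => ∑ j ∈ Finset.range k, ξ j ω :=
  Finset.stronglyMeasurable_fun_sum _ fun j hj =>
    (hm j).mono (𝒢.mono (Finset.mem_range.1 hj))

theorem ae_sum_range_le (hb : ∀ k, ∀ᵐ ω ∂μ, |ξ k ω| ≤ c k) (k : ℕ) :
    ∀ᵐ ω ∂μ, ∑ j ∈ Finset.range k, ξ j ω ≤ ∑ j ∈ Finset.range k, c j := by
  filter_upwards [ae_all_iff.2 hb] with ω hω
  exact Finset.sum_le_sum fun j _ => (le_abs_self _).trans (hω j)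

variable {s : ℝ}

theorem integrable_exp_sum_range (hm : ∀ k, StronglyMeasurable[𝒢 (k + 1)] (ξ k))
    (hb : ∀ k, ∀ᵐ ω ∂μ, |ξ k ω| ≤ c k) (hs : 0 ≤ s) (k : ℕ) :
    Integrable (fun ω => Real.exp (s * ∑ j ∈ Finset.range k, ξ j ω)) μ := by
  refine Integrable.of_bound (C := Real.exp (s * ∑ j ∈ Finset.range k, c j)) ?_ ?_
  · exact (Real.continuous_exp.comp_stronglyMeasurable
      (((stronglyMeasurable_sum_range hm k).mono (𝒢.le k)).const_mul s)).aestronglyMeasurable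
  · filter_upwards [ae_sum_range_le hb k] with ω hω
    rw [Real.norm_eq_abs, Real.abs_exp]
    exact Real.exp_le_exp.2 (mul_le_mul_of_nonneg_left hω hs)

theorem integrable_exp_sum_range_mul (hm : ∀ k, StronglyMeasurable[𝒢 (k + 1)] (ξ k))
    (hb : ∀ k, ∀ᵐ ω ∂μ, |ξ k ω| ≤ c k) (hs : 0 ≤ s) (k : ℕ) :
    Integrable (fun ω => Real.exp (s * ∑ j ∈ Finset.range k, ξ j ω) * ξ k ω) μ :=
  (integrable_exp_sum_range hm hb hs k).mul_bdd (c := c k)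
    ((hm k).mono (𝒢.le (k + 1))).aestronglyMeasurable (hb k)

theorem condExp_exp_sum_range_mul (hm : ∀ k, StronglyMeasurable[𝒢 (k + 1)] (ξ k))
    (hb : ∀ k, ∀ᵐ ω ∂μ, |ξ k ω| ≤ c k) (h0 : ∀ k, μ[ξ k | 𝒢 k] =ᵐ[μ] 0) (hs : 0 ≤ s) (k : ℕ) :
    μ[fun ω => Real.exp (s * ∑ j ∈ Finset.range k, ξ j ω) * ξ k ω | 𝒢 k] =ᵐ[μ] 0 := by
  have hi : Integrable (ξ k) μ :=
    Integrable.of_bound ((hm k).mono (𝒢.le (k + 1))).aestronglyMeasurable (c k) (hb k)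
  have h := condExp_mul_of_stronglyMeasurable_left
    (Real.continuous_exp.comp_stronglyMeasurable
      ((stronglyMeasurable_sum_range hm k).const_mul s))
    (integrable_exp_sum_range_mul hm hb hs k) hi
  filter_upwards [h, h0 k] with ω h1 h2
  refine h1.trans ?_
  simp [h2]

/-- The inequality 1 + x ≤ eˣ and the centring of ξ give the submartingale property. It serves only
Doob's maximal inequality; the size of the exponential moment is estimated separately. -/
theorem submartingale_exp_sum_range (hm : ∀ k, StronglyMeasurable[𝒢 (k + 1)] (ξ k))
    (hb : ∀ k, ∀ᵐ ω ∂μ, |ξ k ω| ≤ c k) (h0 : ∀ k, μ[ξ k | 𝒢 k] =ᵐ[μ] 0) (hs : 0 ≤ s) :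
    Submartingale (fun k ω => Real.exp (s * ∑ j ∈ Finset.range k, ξ j ω)) 𝒢 μ := by
  have hY : ∀ k, StronglyMeasurable[𝒢 k]
      fun ω => Real.exp (s * ∑ j ∈ Finset.range k, ξ j ω) := fun k =>
    Real.continuous_exp.comp_stronglyMeasurable ((stronglyMeasurable_sum_range hm k).const_mul s)
  have hI := fun k => integrable_exp_sum_range hm hb hs k
  have hIm := fun k => integrable_exp_sum_range_mul hm hb hs k
  refine submartingale_nat hY hI fun k => ?_
  have h1 := condExp_add (m := 𝒢 k) (hI k) ((hIm k).const_mul s)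
  have h2 := condExp_smul (μ := μ) s
    (fun ω => Real.exp (s * ∑ j ∈ Finset.range k, ξ j ω) * ξ k ω) (𝒢 k)
  have h3 := condExp_of_stronglyMeasurable (𝒢.le k) (hY k) (hI k)
  have h4 := condExp_mono (m := 𝒢 k) ((hI k).add ((hIm k).const_mul s)) (hI (k + 1))
    (Filter.Eventually.of_forall fun ω => ?_)
  · filter_upwards [h1, h2, h4, condExp_exp_sum_range_mul hm hb h0 hs k] with ω g1 g2 g4 g5
    refine le_trans (le_of_eq ?_) g4
    rw [g1, Pi.add_apply, h3]
    rw [show (fun ω => s * (Real.exp (s * ∑ j ∈ Finset.range k, ξ j ω) * ξ k ω)) =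
      s • fun ω => Real.exp (s * ∑ j ∈ Finset.range k, ξ j ω) * ξ k ω from rfl, g2,
      Pi.smul_apply, g5]
    simp
  · simp only [Pi.add_apply]
    rw [Finset.sum_range_succ, mul_add, Real.exp_add]
    nlinarith [Real.add_one_le_exp (s * ξ k ω),
      Real.exp_pos (s * ∑ j ∈ Finset.range k, ξ j ω)]

/-- By convexity the exponential lies below its chord over [−b, b]. For b = 0 the division yields 0,
and x = 0. -/
theorem exp_mul_le_cosh_add {x b : ℝ} (hx : |x| ≤ b) :
    Real.exp (s * x) ≤ Real.cosh (s * b) + x * (Real.sinh (s * b) / b) := by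
  have hb : 0 ≤ b := (abs_nonneg x).trans hx
  rcases hb.eq_or_lt with rfl | hb
  · have : x = 0 := abs_nonpos_iff.1 hx
    simp [this]
  · have h : |x / b| ≤ 1 := by
      rw [abs_div, abs_of_pos hb]
      exact div_le_one_of_le₀ hx hb.le
    have := Real.exp_mul_le_cosh_add_mul_sinh h (s * b)
    rw [show x / b * (s * b) = s * x by field_simp] at this
    refine this.trans (le_of_eq ?_)
    ring

theorem integral_exp_sum_range_le (hm : ∀ k, StronglyMeasurable[𝒢 (k + 1)] (ξ k))
    (hb : ∀ k, ∀ᵐ ω ∂μ, |ξ k ω| ≤ c k) (h0 : ∀ k, μ[ξ k | 𝒢 k] =ᵐ[μ] 0) (hs : 0 ≤ s) (n : ℕ) :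
    ∫ ω, Real.exp (s * ∑ j ∈ Finset.range n, ξ j ω) ∂μ ≤
      Real.exp (s ^ 2 * (∑ j ∈ Finset.range n, c j ^ 2) / 2) := by
  induction n with
  | zero => simp
  | succ k ih =>
    have hI := fun k => integrable_exp_sum_range hm hb hs k
    have hIm := fun k => integrable_exp_sum_range_mul hm hb hs k
    -- The linear term of the chord has mean zero, so each new increment costs only a factor cosh(s
    -- c_k) ≤ exp((s c_k)²/2).
    have hz : ∫ ω, Real.exp (s * ∑ j ∈ Finset.range k, ξ j ω) * ξ k ω ∂μ = 0 := by
      rw [← integral_condExp (𝒢.le k),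
        integral_congr_ae (condExp_exp_sum_range_mul hm hb h0 hs k)]
      simp
    calc ∫ ω, Real.exp (s * ∑ j ∈ Finset.range (k + 1), ξ j ω) ∂μ
        ≤ ∫ ω, (Real.exp (s * ∑ j ∈ Finset.range k, ξ j ω) * Real.cosh (s * c k) +
            Real.exp (s * ∑ j ∈ Finset.range k, ξ j ω) * ξ k ω *
              (Real.sinh (s * c k) / c k)) ∂μ := by
          refine integral_mono_ae (hI (k + 1)) (((hI k).mul_const _).add
            ((hIm k).mul_const _)) ?_
          filter_upwards [hb k] with ω hω
          rw [Finset.sum_range_succ, mul_add, Real.exp_add, mul_assoc _ (ξ k ω), ← mul_add]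
          exact mul_le_mul_of_nonneg_left (exp_mul_le_cosh_add hω) (Real.exp_pos _).le
      _ = (∫ ω, Real.exp (s * ∑ j ∈ Finset.range k, ξ j ω) ∂μ) * Real.cosh (s * c k) := by
          rw [integral_add ((hI k).mul_const _) ((hIm k).mul_const _), integral_mul_const,
            integral_mul_const, hz, zero_mul, add_zero]
      _ ≤ Real.exp (s ^ 2 * (∑ j ∈ Finset.range k, c j ^ 2) / 2) *
            Real.exp ((s * c k) ^ 2 / 2) :=
          mul_le_mul ih (Real.cosh_le_exp_half_sq _) (Real.cosh_pos _).le (Real.exp_pos _).le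
      _ = _ := by
          rw [← Real.exp_add, Finset.sum_range_succ]
          ring_nf

/-- The maximal Azuma–Hoeffding inequality. -/
theorem measure_exists_sum_range_ge_le (hm : ∀ k, StronglyMeasurable[𝒢 (k + 1)] (ξ k))
    (hb : ∀ k, ∀ᵐ ω ∂μ, |ξ k ω| ≤ c k) (h0 : ∀ k, μ[ξ k | 𝒢 k] =ᵐ[μ] 0) {n : ℕ} {v t : ℝ}
    (hv : 0 < v) (hc : ∑ j ∈ Finset.range n, c j ^ 2 ≤ v) (ht : 0 ≤ t) :
    μ.real {ω | ∃ k ≤ n, t ≤ ∑ j ∈ Finset.range k, ξ j ω} ≤ Real.exp (-t ^ 2 / (2 * v)) := by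
  have hs : 0 ≤ t / v := by positivity
  -- This value minimizes exp(s²v/2 − st).
  set s := t / v with hsdef
  have hI := integrable_exp_sum_range hm hb hs n
  have hmax := maximal_ineq (submartingale_exp_sum_range hm hb h0 hs)
    (fun k ω => (Real.exp_pos _).le) (ε := ⟨Real.exp (s * t), (Real.exp_pos _).le⟩) n
  set B : Set Ω := {ω | ((⟨Real.exp (s * t), (Real.exp_pos _).le⟩ : NNReal) : ℝ) ≤
    (Finset.range (n + 1)).sup' Finset.nonempty_range_add_one
      fun k => Real.exp (s * ∑ j ∈ Finset.range k, ξ j ω)} with hB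
  have hsub : {ω | ∃ k ≤ n, t ≤ ∑ j ∈ Finset.range k, ξ j ω} ⊆ B := by
    rintro ω ⟨k, hk, hle⟩
    rw [hB, Set.mem_ofPred_eq, Finset.le_sup'_iff]
    refine ⟨k, Finset.mem_range.2 (Nat.lt_succ_of_le hk), ?_⟩
    exact Real.exp_le_exp.2 (mul_le_mul_of_nonneg_left hle hs)
  have h1 : Real.exp (s * t) * μ.real B ≤ Real.exp (s ^ 2 * v / 2) := by
    have h2 : ∫ ω in B, Real.exp (s * ∑ j ∈ Finset.range n, ξ j ω) ∂μ ≤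
        Real.exp (s ^ 2 * v / 2) := by
      refine (setIntegral_le_integral hI
        (Filter.Eventually.of_forall fun ω => (Real.exp_pos _).le)).trans
        ((integral_exp_sum_range_le hm hb h0 hs n).trans (Real.exp_le_exp.2 ?_))
      gcongr
    have h3 := ENNReal.toReal_mono ENNReal.ofReal_ne_top
      (hmax.trans (ENNReal.ofReal_le_ofReal h2))
    rw [ENNReal.toReal_mul, ENNReal.toReal_ofReal (Real.exp_pos _).le] at h3
    exact h3
  calc _ ≤ μ.real B := measureReal_mono hsub
    _ ≤ Real.exp (s ^ 2 * v / 2) / Real.exp (s * t) := by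
        rw [le_div_iff₀ (Real.exp_pos _), mul_comm]; exact h1
    _ = _ := by
        rw [← Real.exp_sub]
        congr 1
        rw [hsdef]
        field_simp
        ring

end Azuma

/-! ### Conditional expectations of functions of a discrete variable. -/

section Countable

variable {Ω D : Type*} [Countable D]

theorem measurable_comp_countable {β : Type*} [MeasurableSpace β] {m : MeasurableSpace Ω}
    {Y : Ω → D} (hY : ∀ d, MeasurableSet[m] {ω | Y ω = d}) {g : D → Ω → β}
    (hg : ∀ d, Measurable[m] (g d)) : Measurable[m] fun ω => g (Y ω) ω := by
  intro B hB
  have : (fun ω => g (Y ω) ω) ⁻¹' B = ⋃ d, {ω | Y ω = d} ∩ g d ⁻¹' B := by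
    ext ω; simp
  rw [this]
  exact MeasurableSet.iUnion fun d => (hY d).inter (hg d hB)

variable {m m' m0 : MeasurableSpace Ω} {μ : Measure Ω} [IsProbabilityMeasure μ]

/-- If the conditional law of a discrete variable `Y` given `m'` agrees with the one given the
smaller σ-algebra `m`, then so do the conditional expectations of functions of `Y` whose
coefficients are `m`-measurable. -/
theorem condExp_comp_countable_eq (hm : m ≤ m') (hm' : m' ≤ m0) {Y : Ω → D}
    (hY : ∀ d, MeasurableSet {ω | Y ω = d})
    (hind : ∀ d, μ[Set.indicator {ω | Y ω = d} (fun _ => (1 : ℝ)) | m'] =ᵐ[μ]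
      μ[Set.indicator {ω | Y ω = d} (fun _ => (1 : ℝ)) | m])
    {g : D → Ω → ℝ} (hg : ∀ d, Measurable[m] (g d))
    (hint : Integrable (fun ω => g (Y ω) ω) μ) :
    μ[fun ω => g (Y ω) ω | m'] =ᵐ[μ] μ[fun ω => g (Y ω) ω | m] := by
  classical
  obtain ⟨e, he⟩ := exists_injective_nat D
  have hfin : ∀ n : ℕ, {d | e d < n}.Finite := fun n =>
    (Set.finite_lt_nat n).preimage he.injOn
  -- On {Y = d} the function is an `m`-measurable coefficient times an indicator, and the
  -- coefficient can be pulled out under either σ-algebra. Finite sums over an enumeration of D then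
  -- converge by dominated convergence in L¹.
  let u : D → Ω → ℝ := fun d => g d * Set.indicator {ω | Y ω = d} (fun _ => (1 : ℝ))
  have hu : ∀ d ω, u d ω = if Y ω = d then g (Y ω) ω else 0 := by
    intro d ω
    by_cases h : Y ω = d
    · simp [u, h]
    · simp [u, h]
  have huI : ∀ d, Integrable (u d) μ := by
    intro d
    have : u d = Set.indicator {ω | Y ω = d} fun ω => g (Y ω) ω := by
      ext ω; rw [hu]; simp [Set.indicator_apply]
    rw [this]
    exact hint.indicator (hY d)
  let fs : ℕ → Ω → ℝ := fun n => ∑ d ∈ (hfin n).toFinset, u d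
  have hfs : ∀ n ω, fs n ω = if e (Y ω) < n then g (Y ω) ω else 0 := by
    intro n ω
    simp only [fs, Finset.sum_apply, hu]
    rw [Finset.sum_ite_eq]
    simp
  have hfsI : ∀ n, Integrable (fs n) μ := fun n => integrable_finsetSum' _ fun d _ => huI d
  have hindI : ∀ d, Integrable (Set.indicator {ω | Y ω = d} (fun _ => (1 : ℝ))) μ := fun d =>
    (integrable_const 1).indicator (hY d)
  have hpull : ∀ d, μ[u d | m'] =ᵐ[μ] μ[u d | m] := by
    intro d
    refine (condExp_mul_of_stronglyMeasurable_left ((hg d).mono hm le_rfl).stronglyMeasurable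
      (huI d) (hindI d)).trans ?_
    refine Filter.EventuallyEq.trans ?_ (condExp_mul_of_stronglyMeasurable_left
      (hg d).stronglyMeasurable (huI d) (hindI d)).symm
    filter_upwards [hind d] with ω hω
    simp [hω]
  have hsum : ∀ n, μ[fs n | m'] =ᵐ[μ] μ[fs n | m] := by
    intro n
    refine (condExp_finsetSum (fun d _ => huI d) m').trans ?_
    refine Filter.EventuallyEq.trans ?_ (condExp_finsetSum (fun d _ => huI d) m).symm
    filter_upwards [ae_all_iff.2 hpull] with ω hω
    simp [hω]
  have hmm : m ≤ m0 := hm.trans hm'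
  have hlim : ∀ (m₁ : MeasurableSpace Ω) (h₁ : m₁ ≤ m0),
      Filter.Tendsto (fun n => condExpL1 h₁ μ (fs n)) Filter.atTop
        (nhds (condExpL1 h₁ μ fun ω => g (Y ω) ω)) := by
    intro m₁ h₁
    refine tendsto_condExpL1_of_dominated_convergence h₁ (fun ω => ‖g (Y ω) ω‖)
      (fun n => (hfsI n).aestronglyMeasurable) hint.norm
      (fun n => Filter.Eventually.of_forall fun ω => ?_) (Filter.Eventually.of_forall fun ω => ?_)
    · rw [hfs]; split_ifs <;> simp
    · refine tendsto_const_nhds.congr' ?_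
      filter_upwards [Filter.eventually_gt_atTop (e (Y ω))] with n hn
      rw [hfs, if_pos hn]
  have heq : ∀ n, condExpL1 hm' μ (fs n) = condExpL1 hmm μ (fs n) := fun n => by
    apply Lp.ext
    exact (condExp_ae_eq_condExpL1 hm' _).symm.trans
      ((hsum n).trans (condExp_ae_eq_condExpL1 hmm _))
  have hl := hlim m' hm'
  simp only [heq] at hl
  have := tendsto_nhds_unique hl (hlim m hmm)
  exact (condExp_ae_eq_condExpL1 hm' _).trans
    (this ▸ (condExp_ae_eq_condExpL1 hmm _).symm)

end Countable

/-! ### Measurability of the iterates and histories of a run. -/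

section RunMeasurability

variable {S A : Type*} [Fintype S] [Fintype A] {Ω : Type*}
  {X : ℕ → ℕ → ℕ → Ω → S × A} {H : ℕ → ℕ → Ω → ℕ} {l k : ℕ}

theorem measurableSet_stoppedTraj_eq {m : MeasurableSpace Ω}
    (hX : ∀ t z, MeasurableSet[m] {ω | X l k t ω = z})
    (hH : ∀ n, MeasurableSet[m] {ω | H l k ω = n}) (τ : List (S × A)) :
    MeasurableSet[m] {ω | stoppedTraj X H l k ω = τ} := by
  -- A stopped trajectory has H + 1 entries: it is never empty, and H is the length of its tail.
  rcases τ with _ | ⟨z, τ⟩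
  · simp [stoppedTraj]
  have : {ω | stoppedTraj X H l k ω = z :: τ} = {ω | H l k ω = τ.length} ∩
      ⋂ (i : ℕ) (hi : i < (z :: τ).length), {ω | X l k i ω = (z :: τ)[i]} := by
    ext ω
    simp only [Set.mem_inter_iff, Set.mem_iInter, Set.mem_ofPred_eq, stoppedTraj]
    constructor
    · intro h
      have hl := congrArg List.length h
      simp only [List.length_ofFn, List.length_cons, add_left_inj] at hl
      refine ⟨hl, fun i hi => ?_⟩
      simp only [← h, List.getElem_ofFn]
    · rintro ⟨h1, h2⟩
      refine List.ext_getElem (by simp [h1]) fun i _ hi => ?_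
      rw [List.getElem_ofFn]
      exact h2 i hi
  rw [this]
  exact (hH _).inter (MeasurableSet.iInter fun i => MeasurableSet.iInter fun _ => hX _ _)

theorem measurable_gradEst {P : PhasedPGInput S A} {θ : ℕ → ℕ → Ω → Param S A}
    {m : MeasurableSpace Ω} (hθ : Measurable[m] (θ l k))
    (hX : ∀ t z, MeasurableSet[m] {ω | X l k t ω = z})
    (hH : ∀ n, MeasurableSet[m] {ω | H l k ω = n}) :
    Measurable[m] (gradEst P θ X H l k) :=
  measurable_comp_countable (measurableSet_stoppedTraj_eq hX hH)
    fun τ => (P.estimator_measurable l k τ).comp hθ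

theorem sigmaTraj_measurableSet (t : ℕ) (z : S × A) :
    MeasurableSet[sigmaTraj X H l k] {ω | X l k t ω = z} := by
  have h : MeasurableSpace.comap (X l k t) ⊤ ≤ sigmaTraj X H l k :=
    (le_iSup (fun t => MeasurableSpace.comap (X l k t) ⊤) t).trans le_sup_left
  exact h _ ⟨{z}, trivial, rfl⟩

theorem sigmaTraj_measurableSet_length (n : ℕ) :
    MeasurableSet[sigmaTraj X H l k] {ω | H l k ω = n} := by
  have h : MeasurableSpace.comap (H l k) ⊤ ≤ sigmaTraj X H l k := le_sup_right
  exact h _ ⟨{n}, trivial, rfl⟩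

variable {θ : ℕ → ℕ → Ω → Param S A} {T : ℕ → ℕ}

theorem sigmaIter_le_sigmaHist {i : ℕ} (hi : i ≤ k) :
    sigmaIter θ l i ≤ sigmaHist T θ X H l k :=
  le_sup_of_le_left (le_iSup_of_le l (le_iSup_of_le i (le_iSup_of_le (Or.inr ⟨rfl, hi⟩) le_rfl)))

theorem sigmaTraj_le_sigmaHist {i : ℕ} (hi : i < k) :
    sigmaTraj X H l i ≤ sigmaHist T θ X H l k :=
  le_sup_of_le_right (le_iSup_of_le l (le_iSup_of_le i (le_iSup_of_le (Or.inr ⟨rfl, hi⟩) le_rfl)))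

theorem sigmaHist_mono {k' : ℕ} (hk : k ≤ k') :
    sigmaHist T θ X H l k ≤ sigmaHist T θ X H l k' := by
  refine sup_le_sup ?_ ?_ <;>
  refine iSup_mono fun j => iSup_mono fun i => iSup_const_mono fun h => ?_ <;>
  omega

variable [m0 : MeasurableSpace Ω] {M : FiniteMDP S A} {P : PhasedPGInput S A} {μ : Measure Ω}

namespace IsPhasedPGRun

variable (hrun : IsPhasedPGRun M P μ θ X H)
include hrun

theorem length_measurableSet (hk : k < P.T l) (n : ℕ) : MeasurableSet {ω | H l k ω = n} :=
  hrun.length_measurable l k hk (measurableSet_singleton n)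

theorem measurable_iterate (l : ℕ) : ∀ k ≤ P.T l, Measurable (θ l k) := by
  have step : ∀ l, Measurable (θ l 0) → ∀ k ≤ P.T l, Measurable (θ l k) := by
    intro l h0 k
    induction k with
    | zero => exact fun _ => h0
    | succ k ih =>
      intro hk
      have hk' : k < P.T l := hk
      rw [show θ l (k + 1) = fun ω => θ l k ω + P.α l k • gradEst P θ X H l k ω from
        funext (hrun.update l k hk')]
      have hg : Measurable (gradEst P θ X H l k) := measurable_gradEst (ih hk'.le)
        (hrun.traj_measurable l k hk') (hrun.length_measurableSet hk')
      exact (ih hk'.le).add (hg.const_smul (P.α l k))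
  induction l with
  | zero =>
    refine step 0 ?_
    rw [show θ 0 0 = fun _ => P.postprocess P.θinit from funext hrun.init]
    exact measurable_const
  | succ l ih =>
    refine step (l + 1) ?_
    rw [show θ (l + 1) 0 = fun ω => P.postprocess (θ l (P.T l) ω) from
      funext (hrun.next_phase l)]
    exact P.postprocess_measurable.comp (ih _ le_rfl)

theorem sigmaIter_le (hk : k ≤ P.T l) : sigmaIter θ l k ≤ m0 :=
  (hrun.measurable_iterate l k hk).comap_le

theorem sigmaTraj_le (hk : k < P.T l) : sigmaTraj X H l k ≤ m0 := by
  refine sup_le (iSup_le fun t => ?_) ?_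
  · rintro _ ⟨B, -, rfl⟩
    have : X l k t ⁻¹' B = ⋃ z ∈ B, {ω | X l k t ω = z} := by ext ω; simp
    rw [this]
    exact MeasurableSet.biUnion (Set.to_countable B) fun z _ => hrun.traj_measurable l k hk t z
  · rintro _ ⟨B, -, rfl⟩
    exact hrun.length_measurable l k hk trivial

theorem sigmaHist_le (hk : k ≤ P.T l) : sigmaHist P.T θ X H l k ≤ m0 := by
  refine sup_le (iSup_le fun j => iSup_le fun i => iSup_le fun h => hrun.sigmaIter_le ?_)
    (iSup_le fun j => iSup_le fun i => iSup_le fun h => hrun.sigmaTraj_le ?_)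
  · rcases h with h | ⟨rfl, h⟩ <;> omega
  · rcases h with h | ⟨rfl, h⟩ <;> omega

variable [IsProbabilityMeasure μ]

/-- Functions of `θ^{l,k}` and the episode's trajectory have the same conditional expectation
given the history as given `θ^{l,k}`. -/
theorem condExp_sigmaHist_eq (hk : k < P.T l) {g : List (S × A) → Param S A → ℝ}
    (hg : ∀ τ, Measurable (g τ))
    (hint : Integrable (fun ω => g (stoppedTraj X H l k ω) (θ l k ω)) μ) :
    μ[fun ω => g (stoppedTraj X H l k ω) (θ l k ω) | sigmaHist P.T θ X H l k] =ᵐ[μ]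
      μ[fun ω => g (stoppedTraj X H l k ω) (θ l k ω) | sigmaIter θ l k] := by
  -- `condIndep` concerns trajectory events only. Stopped trajectories form a countable set of
  -- lists, so functions that also involve θ are covered.
  refine condExp_comp_countable_eq (sigmaIter_le_sigmaHist le_rfl) (hrun.sigmaHist_le hk.le)
    (measurableSet_stoppedTraj_eq (hrun.traj_measurable l k hk) (hrun.length_measurableSet hk))
    (fun τ => hrun.condIndep l k hk _ (measurableSet_stoppedTraj_eq
      sigmaTraj_measurableSet sigmaTraj_measurableSet_length τ))
    (g := fun τ ω => g τ (θ l k ω)) (fun τ => ?_) hint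
  exact (hg τ).comp (comap_measurable (θ l k))

end IsPhasedPGRun

end RunMeasurability

/-! ### The step sizes. -/

section StepSizes

/-- The normalized step size `1 / (√(k+3) log₂(k+3))`. -/
noncomputable def unitStep (k : ℕ) : ℝ := 1 / (√((k : ℝ) + 3) * Real.logb 2 ((k : ℝ) + 3))

/-- Both factors are at least 3/2, since 3 ≥ 9/4 and 3 ≥ 2^{3/2}. The resulting bound 1/2 on the
unit step is used in the ascent inequality and in the quartic part of the noise bound. -/
theorem two_le_sqrt_mul_logb (k : ℕ) : 2 ≤ √((k : ℝ) + 3) * Real.logb 2 ((k : ℝ) + 3) := by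
  have hk : (0 : ℝ) ≤ k := k.cast_nonneg
  have h1 : 3 / 2 ≤ √((k : ℝ) + 3) := Real.le_sqrt_of_sq_le (by nlinarith)
  have h2 : 3 / 2 ≤ Real.logb 2 ((k : ℝ) + 3) := by
    rw [Real.le_logb_iff_rpow_le (by norm_num) (by positivity)]
    have : (2 : ℝ) ^ (3 / 2 : ℝ) ≤ 3 := by
      refine (le_abs_self _).trans (abs_le_of_sq_le_sq ?_ (by norm_num))
      rw [← Real.rpow_natCast, ← Real.rpow_mul (by norm_num)]
      norm_num
    linarith
  nlinarith

theorem unitStep_pos (k : ℕ) : 0 < unitStep k :=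
  div_pos one_pos (two_pos.trans_le (two_le_sqrt_mul_logb k))

theorem unitStep_le_half (k : ℕ) : unitStep k ≤ 1 / 2 :=
  one_div_le_one_div_of_le two_pos (two_le_sqrt_mul_logb k)

theorem unitStep_antitone : Antitone unitStep := by
  intro i j hij
  have hi : (0 : ℝ) ≤ i := i.cast_nonneg
  have hij' : (i : ℝ) ≤ j := by exact_mod_cast hij
  refine one_div_le_one_div_of_le (two_pos.trans_le (two_le_sqrt_mul_logb i)) ?_
  exact mul_le_mul (Real.sqrt_le_sqrt (by linarith))
    (Real.logb_le_logb_of_le (by norm_num) (by linarith) (by linarith))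
    (Real.logb_nonneg (by norm_num) (by linarith)) (Real.sqrt_nonneg _)

/-- The terms (log 2)²/((k+3) log²(k+3)) are dominated by (log 2)² times differences of 1/log. With
the offset 3 the telescoped total is at most log 2 ≤ 1. -/
theorem sum_unitStep_sq_le_one (n : ℕ) : ∑ k ∈ Finset.range n, unitStep k ^ 2 ≤ 1 := by
  have hl2 : 0 < Real.log 2 := Real.log_pos (by norm_num)
  have key : ∑ k ∈ Finset.range n, unitStep k ^ 2 ≤
      Real.log 2 ^ 2 * (1 / Real.log 2 - 1 / Real.log ((n : ℝ) + 2)) := by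
    induction n with
    | zero => simp
    | succ n ih =>
      rw [Finset.sum_range_succ]
      have hn : (0 : ℝ) ≤ n := n.cast_nonneg
      have ha : 0 < Real.log ((n : ℝ) + 2) := Real.log_pos (by linarith)
      have hb : 0 < Real.log ((n : ℝ) + 3) := Real.log_pos (by linarith)
      have hab : Real.log ((n : ℝ) + 2) ≤ Real.log ((n : ℝ) + 3) :=
        Real.log_le_log (by linarith) (by linarith)
      have hd : 1 / ((n : ℝ) + 3) ≤ Real.log ((n : ℝ) + 3) - Real.log ((n : ℝ) + 2) := by
        have := Real.log_le_sub_one_of_pos (x := ((n : ℝ) + 2) / (n + 3)) (by positivity)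
        rw [Real.log_div (by positivity) (by positivity)] at this
        have e : ((n : ℝ) + 2) / (n + 3) - 1 = -(1 / (n + 3)) := by field_simp; ring
        linarith
      have hs : unitStep n ^ 2 =
          Real.log 2 ^ 2 * (1 / (n + 3) / Real.log ((n : ℝ) + 3) ^ 2) := by
        rw [unitStep, div_pow, mul_pow, Real.sq_sqrt (by positivity), Real.logb]
        field_simp
      have hstep : 1 / ((n : ℝ) + 3) / Real.log ((n : ℝ) + 3) ^ 2 ≤
          1 / Real.log ((n : ℝ) + 2) - 1 / Real.log ((n : ℝ) + 3) := by
        rw [div_sub_div _ _ ha.ne' hb.ne', one_mul, mul_one]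
        refine div_le_div₀ (by linarith) hd (by positivity) ?_
        nlinarith
      have := mul_le_mul_of_nonneg_left hstep (sq_nonneg (Real.log 2))
      push_cast
      rw [show (n : ℝ) + 1 + 2 = n + 3 by ring, hs]
      linarith
  refine key.trans ?_
  have hn : 0 ≤ 1 / Real.log ((n : ℝ) + 2) :=
    one_div_nonneg.2 (Real.log_nonneg (by linarith [n.cast_nonneg (α := ℝ)]))
  have h1 : Real.log 2 ≤ 1 := by
    have := Real.log_le_sub_one_of_pos (x := 2) (by norm_num); linarith
  calc _ ≤ Real.log 2 ^ 2 * (1 / Real.log 2) := by gcongr; linarith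
    _ = Real.log 2 := by field_simp
    _ ≤ 1 := h1

end StepSizes

/-! ### Deterministic counting of the episodes with large gradient. -/

section Descent

/-- Cauchy–Schwarz produces x = √C·C_α, whereas D_l contains x². A small x is not controlled by x²,
but the gap of an episode is then itself at most x + w, which makes the trade possible. The factor
4/3 is attained at x = w = 1/2, g = 1. -/
theorem mul_min_le {x w g : ℝ} (hx : 0 ≤ x) (hw : 0 ≤ w) (hg : 1 ≤ g) :
    (x + w) * min g (x + w) ≤ 4 / 3 * g * (x ^ 2 + w) := by
  rcases le_or_gt 1 (x + w) with h | h
  · have h1 : (x + w) ≤ 4 / 3 * (x ^ 2 + w) := by nlinarith [sq_nonneg (2 * x - 1)]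
    calc (x + w) * min g (x + w) ≤ (x + w) * g :=
          mul_le_mul_of_nonneg_left (min_le_left _ _) (by positivity)
      _ ≤ 4 / 3 * (x ^ 2 + w) * g := mul_le_mul_of_nonneg_right h1 (by linarith)
      _ = _ := by ring
  · have h1 : (x + w) * (x + w) ≤ 4 / 3 * (x ^ 2 + w) := by
      nlinarith [sq_nonneg (x - w), mul_nonneg hw (sub_nonneg.2 h.le)]
    calc (x + w) * min g (x + w) ≤ (x + w) * (x + w) :=
          mul_le_mul_of_nonneg_left (min_le_right _ _) (by positivity)
      _ ≤ 4 / 3 * (x ^ 2 + w) := h1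
      _ ≤ 4 / 3 * (x ^ 2 + w) * g := le_mul_of_one_le_right (by positivity) hg
      _ = _ := by ring

/-- The deterministic part of the regret analysis: if the objective values `v k` satisfy an
approximate ascent inequality with step sizes `Cα * unitStep k` and gradient norms `G k`, then
the optimality gaps `Fs - f k` add up slowly. -/
theorem sum_gap_le {v f G d ξ : ℕ → ℝ} {Fs g Cα C C₂ b N κ e : ℝ} {K : ℕ}
    (hCα : 0 < Cα) (hC₂ : 0 < C₂) (hC : 0 ≤ C) (hb : 0 ≤ b) (hκ : 0 < κ) (hg : 1 ≤ g)
    (he : 0 ≤ e) (hN : 0 ≤ N)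
    (hstep : ∀ k ≤ K, v k + (3 / 4 * (Cα * unitStep k) * C₂ * G k ^ 2 - Cα * unitStep k * d k -
      b * (Cα * unitStep k) ^ 2) - ξ k ≤ v (k + 1))
    (hnoise : ∀ k ≤ K + 1, ∑ j ∈ Finset.range k, ξ j ≤ N)
    (hd : ∑ k ∈ Finset.range (K + 1), d k ^ 2 ≤ C)
    (hv : ∀ k, v k ≤ f k) (hf : ∀ k, f k ≤ Fs) (hgap : ∀ k, Fs - f k ≤ g)
    (hdom : ∀ k, G k ≤ κ → Fs - f k ≤ e) :
    ∑ k ∈ Finset.range (K + 1), (Fs - f k) ≤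
      16 / 9 * g * (C * Cα ^ 2 + b * Cα ^ 2 + (Fs - v 0) + N) /
        (C₂ * (Cα * unitStep K) * κ ^ 2) + (K + 1) * e := by
  set a : ℕ → ℝ := fun k => Cα * unitStep k with ha
  have hapos : ∀ k, 0 < a k := fun k => mul_pos hCα (unitStep_pos k)
  have hw0 : 0 ≤ Fs - v 0 := by linarith [hv 0, hf 0]
  -- x bounds the accumulated bias by Cauchy–Schwarz; w collects the second-moment terms, the
  -- initial gap and the noise.
  set x := √C * Cα with hx
  set w := b * Cα ^ 2 + (Fs - v 0) + N with hw
  have hxn : 0 ≤ x := by positivity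
  have hwn : 0 ≤ w := by positivity
  have hasq : ∀ n, ∑ k ∈ Finset.range n, a k ^ 2 ≤ Cα ^ 2 := by
    intro n
    simp only [ha, mul_pow, ← Finset.mul_sum]
    exact mul_le_of_le_one_right (sq_nonneg _) (sum_unitStep_sq_le_one n)
  have had : ∀ n ≤ K + 1, ∑ k ∈ Finset.range n, a k * d k ≤ x := by
    intro n hn
    refine (le_abs_self _).trans (abs_le_of_sq_le_sq ?_ hxn)
    refine (Finset.sum_mul_sq_le_sq_mul_sq _ _ _).trans ?_
    have h1 : ∑ k ∈ Finset.range n, d k ^ 2 ≤ C :=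
      (Finset.sum_le_sum_of_subset_of_nonneg (Finset.range_mono hn)
        fun _ _ _ => sq_nonneg _).trans hd
    rw [hx, mul_pow, Real.sq_sqrt hC, mul_comm]
    exact mul_le_mul h1 (hasq n) (Finset.sum_nonneg fun _ _ => sq_nonneg _) hC
  have htel : ∀ n ≤ K + 1, v 0 + ∑ k ∈ Finset.range n, (3 / 4 * a k * C₂ * G k ^ 2) -
      ∑ k ∈ Finset.range n, a k * d k - b * ∑ k ∈ Finset.range n, a k ^ 2 -
      ∑ k ∈ Finset.range n, ξ k ≤ v n := by
    intro n
    induction n with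
    | zero => intro _; simp
    | succ n ih =>
      intro hn
      have h1 := ih (by omega)
      have h2 := hstep n (by omega)
      simp only [Finset.sum_range_succ, mul_add]
      linarith
  have hmain : ∀ n ≤ K + 1,
      ∑ k ∈ Finset.range n, (3 / 4 * a k * C₂ * G k ^ 2) ≤ v n - v 0 + x + b * Cα ^ 2 + N := by
    intro n hn
    have := htel n hn
    have := had n hn
    have := hnoise n hn
    have := mul_le_mul_of_nonneg_left (hasq n) hb
    linarith
  have hsumnn : ∀ n, 0 ≤ ∑ k ∈ Finset.range n, (3 / 4 * a k * C₂ * G k ^ 2) := fun n =>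
    Finset.sum_nonneg fun k _ => by have := hapos k; positivity
  -- The squared gradients in the telescoped inequality are nonnegative, so the objective never
  -- falls more than x + bCα² + N below its start.
  have hgapm : ∀ k ≤ K, Fs - f k ≤ min g (x + w) := by
    intro k hk
    refine le_min (hgap k) ?_
    have := hmain k (by omega)
    have := hsumnn k
    linarith [hv k]
  have hmn : 0 ≤ min g (x + w) := le_min (by linarith) (by positivity)
  -- Steps decrease, so every episode in B uses at least the share of the budget x + w computed with
  -- the last step `a K`.
  set B := (Finset.range (K + 1)).filter fun k => κ < G k with hB
  have hcard : (B.card : ℝ) * (3 / 4 * a K * C₂ * κ ^ 2) ≤ x + w := by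
    calc (B.card : ℝ) * (3 / 4 * a K * C₂ * κ ^ 2)
        = ∑ _k ∈ B, 3 / 4 * a K * C₂ * κ ^ 2 := by rw [Finset.sum_const, nsmul_eq_mul]
      _ ≤ ∑ k ∈ B, 3 / 4 * a k * C₂ * G k ^ 2 := by
          refine Finset.sum_le_sum fun k hk => ?_
          rw [hB, Finset.mem_filter, Finset.mem_range] at hk
          have h1 : a K ≤ a k :=
            mul_le_mul_of_nonneg_left (unitStep_antitone (by omega)) hCα.le
          have := hapos k
          have := hapos K
          have := hk.2
          gcongr
      _ ≤ ∑ k ∈ Finset.range (K + 1), 3 / 4 * a k * C₂ * G k ^ 2 :=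
          Finset.sum_le_sum_of_subset_of_nonneg (Finset.filter_subset _ _)
            fun k _ _ => by have := hapos k; positivity
      _ ≤ x + w := by
          have := hmain (K + 1) le_rfl
          linarith [hv (K + 1), hf (K + 1)]
  have hP : 0 < 3 / 4 * a K * C₂ * κ ^ 2 := by have := hapos K; positivity
  have hsplit : ∑ k ∈ Finset.range (K + 1), (Fs - f k) ≤
      B.card * min g (x + w) + (K + 1) * e := by
    calc _ ≤ ∑ k ∈ Finset.range (K + 1), ((if κ < G k then min g (x + w) else 0) + e) := by
          refine Finset.sum_le_sum fun k hk => ?_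
          rw [Finset.mem_range] at hk
          split_ifs with h
          · linarith [hgapm k (by omega)]
          · linarith [hdom k (not_lt.1 h)]
      _ = _ := by
          rw [Finset.sum_add_distrib, ← Finset.sum_filter, Finset.sum_const, Finset.sum_const,
            nsmul_eq_mul, nsmul_eq_mul, Finset.card_range]
          push_cast
          rfl
  refine hsplit.trans (add_le_add_left ?_ _)
  rw [le_div_iff₀ (by have := hapos K; positivity)]
  -- One factor 4/3 inverts the 3/4 of the ascent inequality and another comes from `mul_min_le`;
  -- together they give 16/9.
  have h1 := mul_le_mul_of_nonneg_right hcard hmn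
  have h2 := mul_min_le hxn hwn hg
  have h3 : x ^ 2 + w = C * Cα ^ 2 + b * Cα ^ 2 + (Fs - v 0) + N := by
    rw [hx, mul_pow, Real.sq_sqrt hC, hw]; ring
  rw [← h3]
  change (B.card : ℝ) * min g (x + w) * (C₂ * a K * κ ^ 2) ≤ _
  linarith

end Descent

/-! ### Truncated returns and conditional expectations along a run. -/

theorem measurable_gradient {E : Type*} [NormedAddCommGroup E] [InnerProductSpace ℝ E]
    [CompleteSpace E] [MeasurableSpace E] [BorelSpace E] (G : E → ℝ) : Measurable (gradient G) := by
  borelize (StrongDual ℝ E)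
  exact (InnerProductSpace.toDual ℝ E).symm.continuous.measurable.comp (measurable_fderiv ℝ G)

theorem measurable_mul_inner_sub {E Ω : Type*} [NormedAddCommGroup E] [InnerProductSpace ℝ E]
    [SecondCountableTopology E] [MeasurableSpace E] [BorelSpace E] {m : MeasurableSpace Ω}
    {u v : Ω → E} (hu : Measurable u) (hv : Measurable v) (a b : ℝ) :
    Measurable fun ω => a * inner ℝ (u ω) (v ω) - b * ‖v ω‖ ^ 2 :=
  ((hu.inner hv).const_mul a).sub ((hv.norm.pow_const 2).const_mul b)

/-- No order between n and N is assumed: n will be fixed while N is a random trajectory length. -/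
theorem sum_range_pow_mul_le_add {γ : ℝ} (hγ0 : 0 ≤ γ) (hγ1 : γ < 1) {r : ℕ → ℝ}
    (hr0 : ∀ t, 0 ≤ r t) (hr1 : ∀ t, r t ≤ 1) (n N : ℕ) :
    ∑ t ∈ Finset.range n, γ ^ t * r t ≤
      ∑ t ∈ Finset.range N, γ ^ t * r t + γ ^ N * (1 / (1 - γ)) := by
  have hnn : ∀ t, 0 ≤ γ ^ t * r t := fun t => mul_nonneg (pow_nonneg hγ0 t) (hr0 t)
  calc ∑ t ∈ Finset.range n, γ ^ t * r t ≤ ∑ t ∈ Finset.range (N + n), γ ^ t * r t :=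
        Finset.sum_le_sum_of_subset_of_nonneg (Finset.range_mono (by omega)) fun t _ _ => hnn t
    _ ≤ ∑ t ∈ Finset.range N, γ ^ t * r t + γ ^ N * ∑ i ∈ Finset.range n, γ ^ i := by
        rw [Finset.sum_range_add, Finset.mul_sum]
        refine add_le_add_right (Finset.sum_le_sum fun i _ => ?_) _
        rw [← pow_add]
        exact mul_le_of_le_one_right (by positivity) (hr1 _)
    _ ≤ _ := by
        gcongr
        rw [one_div, ← tsum_geometric_of_lt_one hγ0 hγ1]
        exact (summable_geometric_of_lt_one hγ0 hγ1).sum_le_tsum _ fun i _ => pow_nonneg hγ0 i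

/-- The return through time H leaves a tail starting at H + 1, whence the extra factor γ. This
factor also makes the case γ = 0 trivial. -/
theorem pow_succ_le_of_logb_le {γ : ℝ} (hγ0 : 0 ≤ γ) (hγ1 : γ < 1) {k h : ℕ}
    (hh : Real.logb (1 / γ) ((k : ℝ) + 1) ≤ h) : γ ^ (h + 1) ≤ γ * (1 / ((k : ℝ) + 1)) := by
  rcases hγ0.eq_or_lt with rfl | hpos
  · simp
  · rw [pow_succ']
    refine mul_le_mul_of_nonneg_left ?_ hγ0
    rw [Real.logb_le_iff_le_rpow ((one_lt_div hpos).2 hγ1) (by positivity), Real.rpow_natCast,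
      div_pow, one_pow] at hh
    exact (le_one_div (by positivity) (by positivity)).1 hh

section Run

variable {S A : Type*} [Fintype S] [Fintype A] [Nonempty S] [Nonempty A] {Ω : Type*}
  [m0 : MeasurableSpace Ω] {M : FiniteMDP S A} {P : PhasedPGInput S A} {μ : Measure Ω}
  [IsProbabilityMeasure μ] {θ : ℕ → ℕ → Ω → Param S A} {X : ℕ → ℕ → ℕ → Ω → S × A}
  {H : ℕ → ℕ → Ω → ℕ} {l k : ℕ}

namespace IsPhasedPGRun

variable (hrun : IsPhasedPGRun M P μ θ X H)
include hrun

theorem measurable_comp_traj (hk : k < P.T l) (t : ℕ) (f : S × A → ℝ) :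
    Measurable fun ω => f (X l k t ω) :=
  measurable_comp_countable (hrun.traj_measurable l k hk t) (g := fun z _ => f z)
    fun _ => measurable_const

theorem integrable_comp_traj (hk : k < P.T l) (t : ℕ) (f : S × A → ℝ) :
    Integrable (fun ω => f (X l k t ω)) μ :=
  Integrable.of_bound (hrun.measurable_comp_traj hk t f).aestronglyMeasurable (∑ z, |f z|)
    (Filter.Eventually.of_forall fun _ =>
      Finset.single_le_sum (f := fun z => |f z|) (fun _ _ => abs_nonneg _) (Finset.mem_univ _))

theorem condExp_comp_traj (hk : k < P.T l) (t : ℕ) (f : S × A → ℝ) :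
    μ[fun ω => f (X l k t ω) | sigmaIter θ l k] =ᵐ[μ]
      fun ω => M.expectAt (softmaxPolicy (θ l k ω)) t f := by
  classical
  let I : (Fin (t + 1) → S × A) → Ω → ℝ := fun x =>
    Set.indicator {ω | ∀ i : Fin (t + 1), X l k i ω = x i} fun _ => (1 : ℝ)
  have hI : ∀ x, Integrable (I x) μ := fun x => by
    refine (integrable_const 1).indicator ?_
    simp only [Set.ofPred_forall]
    exact MeasurableSet.iInter fun i => hrun.traj_measurable l k hk i (x i)
  have e : (fun ω => f (X l k t ω)) = ∑ x, f (x (Fin.last t)) • I x := by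
    ext ω
    rw [Finset.sum_apply, Finset.sum_eq_single fun i : Fin (t + 1) => X l k i ω]
    · simp [I]
    · intro x _ hx
      have : ¬ ∀ i : Fin (t + 1), X l k i ω = x i := fun h => hx (funext fun i => (h i).symm)
      simp [I, this]
    · simp
  rw [e]
  refine (condExp_finsetSum (fun x _ => (hI x).smul _) _).trans ?_
  have h1 : ∀ x, ∀ᵐ ω ∂μ, (μ[f (x (Fin.last t)) • I x | sigmaIter θ l k]) ω =
      f (x (Fin.last t)) * M.pathProb (softmaxPolicy (θ l k ω)) x := by
    intro x
    filter_upwards [condExp_smul (μ := μ) (f (x (Fin.last t))) (I x) (sigmaIter θ l k),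
      hrun.sampling l k hk t x] with ω g1 g2
    rw [g1, Pi.smul_apply, smul_eq_mul, g2]
  filter_upwards [ae_all_iff.2 h1] with ω hω
  rw [Finset.sum_apply]
  simp only [hω, FiniteMDP.expectAt]
  exact Finset.sum_congr rfl fun x _ => mul_comm _ _

/-- Truncating the trajectories costs at most `γ / ((1-γ)(k+1))` in expected reward. -/
theorem F_le_truncValue_add (hk : k < P.T l)
    (hlen : ∀ᵐ ω ∂μ, Real.logb (1 / M.γ) ((k : ℝ) + 1) ≤ H l k ω) :
    ∀ᵐ ω ∂μ, M.F (softmaxPolicy (θ l k ω)) ≤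
      truncValue M μ θ X H l k ω + M.γ / (1 - M.γ) * (1 / ((k : ℝ) + 1)) := by
  have hp := M.one_sub_γ_pos
  have hm := hrun.sigmaIter_le hk.le
  set c : ℝ := M.γ / (1 - M.γ) * (1 / ((k : ℝ) + 1)) with hc
  let q : ℕ → Ω → ℝ := fun n ω =>
    ∑ t ∈ Finset.range n, M.γ ^ t * M.r (X l k t ω).1 (X l k t ω).2
  have hqm : ∀ n, Measurable (q n) := fun n => Finset.measurable_fun_sum _ fun t _ =>
    (hrun.measurable_comp_traj hk t fun z => M.r z.1 z.2).const_mul _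
  have hqle : ∀ n n' ω, q n ω ≤ q n' ω + M.γ ^ n' * (1 / (1 - M.γ)) := fun n n' ω =>
    sum_range_pow_mul_le_add M.γ_nonneg M.γ_lt_one (fun _ => M.r_nonneg _ _)
      (fun _ => M.r_le_one _ _) n n'
  have hq0 : ∀ n ω, 0 ≤ q n ω := fun n ω => Finset.sum_nonneg fun t _ =>
    mul_nonneg (pow_nonneg M.γ_nonneg t) (M.r_nonneg _ _)
  have hqb : ∀ n ω, ‖q n ω‖ ≤ 1 / (1 - M.γ) := fun n ω => by
    rw [Real.norm_eq_abs, abs_of_nonneg (hq0 n ω)]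
    simpa [q] using hqle n 0 ω
  have hqI : ∀ n, Integrable (q n) μ := fun n =>
    Integrable.of_bound (hqm n).aestronglyMeasurable _ (Filter.Eventually.of_forall (hqb n))
  have hfI : Integrable (fun ω => q (H l k ω + 1) ω) μ := by
    refine Integrable.of_bound (Measurable.aestronglyMeasurable ?_) (1 / (1 - M.γ))
      (Filter.Eventually.of_forall fun ω => hqb _ ω)
    exact measurable_comp_countable (hrun.length_measurableSet hk) (g := fun n => q (n + 1))
      fun n => hqm _
  -- Finite partial sums of F are compared with the truncated return, and n tends to infinity only
  -- at the end; no infinite series is conditioned.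
  have hpart : ∀ n, ∀ᵐ ω ∂μ, ∑ t ∈ Finset.range n,
      M.γ ^ t * M.expectAt (softmaxPolicy (θ l k ω)) t (fun z => M.r z.1 z.2) ≤
        truncValue M μ θ X H l k ω + c := by
    intro n
    have h1 : q n ≤ᵐ[μ] (fun ω => q (H l k ω + 1) ω) + fun _ => c := by
      filter_upwards [hlen] with ω hω
      refine (hqle n (H l k ω + 1) ω).trans ?_
      rw [Pi.add_apply]
      have h2 := mul_le_mul_of_nonneg_right (pow_succ_le_of_logb_le M.γ_nonneg M.γ_lt_one hω)
        (one_div_nonneg.2 hp.le)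
      rw [hc]
      calc _ ≤ q (H l k ω + 1) ω + M.γ * (1 / ((k : ℝ) + 1)) * (1 / (1 - M.γ)) := by gcongr
        _ = _ := by ring
    have h2 := condExp_mono (m := sigmaIter θ l k) (hqI n) (hfI.add (integrable_const c)) h1
    have h3 := condExp_add hfI (integrable_const c) (sigmaIter θ l k)
    have hqs : q n = ∑ t ∈ Finset.range n,
        M.γ ^ t • fun ω => M.r (X l k t ω).1 (X l k t ω).2 := by
      ext ω; simp [q]
    have h4 := condExp_finsetSum (s := Finset.range n)
      (f := fun t => M.γ ^ t • fun ω => M.r (X l k t ω).1 (X l k t ω).2)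
      (fun t _ => (hrun.integrable_comp_traj hk t fun z => M.r z.1 z.2).smul (M.γ ^ t))
      (sigmaIter θ l k)
    have h5 : ∀ t, ∀ᵐ ω ∂μ, (μ[M.γ ^ t • fun ω => M.r (X l k t ω).1 (X l k t ω).2 |
        sigmaIter θ l k]) ω =
          M.γ ^ t * M.expectAt (softmaxPolicy (θ l k ω)) t (fun z => M.r z.1 z.2) := by
      intro t
      filter_upwards [condExp_smul (μ := μ) (M.γ ^ t)
        (fun ω => M.r (X l k t ω).1 (X l k t ω).2) (sigmaIter θ l k),
        hrun.condExp_comp_traj hk t fun z => M.r z.1 z.2] with ω g1 g2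
      rw [g1, Pi.smul_apply, smul_eq_mul, g2]
    filter_upwards [h2, h3, h4, ae_all_iff.2 h5] with ω g2 g3 g4 g5
    rw [hqs, g4, Finset.sum_apply, g3, Pi.add_apply, condExp_const hm] at g2
    simp only [g5] at g2
    exact g2
  filter_upwards [ae_all_iff.2 hpart] with ω hω
  exact le_of_tendsto' (M.summable_F (isPolicy_softmaxPolicy _)).hasSum.tendsto_sum_nat hω

end IsPhasedPGRun

/-- The guaranteed increase of the regularized objective in one gradient step of size `a`. -/
noncomputable def ascentTerm (M : FiniteMDP S A) (P : PhasedPGInput S A)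
    (θ : ℕ → ℕ → Ω → Param S A) (X : ℕ → ℕ → ℕ → Ω → S × A) (H : ℕ → ℕ → Ω → ℕ) (l k : ℕ)
    (a : ℝ) (ω : Ω) : ℝ :=
  a * inner ℝ (gradient (M.regObjective (P.lam l)) (θ l k ω)) (gradEst P θ X H l k ω) -
    M.smoothConst (P.lam l) / 2 * a ^ 2 * ‖gradEst P θ X H l k ω‖ ^ 2

theorem measurable_gradEst_of_sigmaAlgebra {m : MeasurableSpace Ω}
    (h1 : sigmaIter θ l k ≤ m) (h2 : sigmaTraj X H l k ≤ m) :
    Measurable[m] (gradEst P θ X H l k) :=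
  measurable_gradEst ((comap_measurable (θ l k)).mono h1 le_rfl)
    (fun t z => h2 _ (sigmaTraj_measurableSet t z))
    (fun n => h2 _ (sigmaTraj_measurableSet_length n))

theorem measurable_ascentTerm {m : MeasurableSpace Ω} (h1 : sigmaIter θ l k ≤ m)
    (h2 : sigmaTraj X H l k ≤ m) (a : ℝ) : Measurable[m] (ascentTerm M P θ X H l k a) := by
  have hg := measurable_gradEst_of_sigmaAlgebra (P := P) h1 h2
  have hG : Measurable[m] fun ω => gradient (M.regObjective (P.lam l)) (θ l k ω) :=
    (measurable_gradient _).comp ((comap_measurable (θ l k)).mono h1 le_rfl)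
  exact measurable_mul_inner_sub hG hg a _

theorem abs_ascentTerm_le {a C₁ : ℝ} (ha : 0 ≤ a) {ω : Ω}
    (h : ‖gradEst P θ X H l k ω‖ ≤ C₁) :
    |ascentTerm M P θ X H l k a ω| ≤
      a * (2 * (1 / (1 - M.γ) ^ 2 + P.lam l)) * C₁ +
        M.smoothConst (P.lam l) / 2 * a ^ 2 * C₁ ^ 2 := by
  have hβ := (M.smoothConst_pos (P.lam_nonneg l)).le
  refine (abs_sub _ _).trans ?_
  rw [abs_mul, abs_of_nonneg ha, mul_assoc a, abs_of_nonneg (by positivity :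
    0 ≤ M.smoothConst (P.lam l) / 2 * a ^ 2 * ‖gradEst P θ X H l k ω‖ ^ 2)]
  have h1 := M.norm_gradient_regObjective_le (θ l k ω) (P.lam_nonneg l)
  gcongr
  refine (abs_real_inner_le_norm _ _).trans ?_
  exact mul_le_mul h1 h (norm_nonneg _) ((norm_nonneg _).trans h1)

namespace IsPhasedPGRun

variable (hrun : IsPhasedPGRun M P μ θ X H)
include hrun

theorem regObjective_succ_ge (hk : k < P.T l) (ω : Ω) :
    M.regObjective (P.lam l) (θ l k ω) + ascentTerm M P θ X H l k (P.α l k) ω ≤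
      M.regObjective (P.lam l) (θ l (k + 1) ω) := by
  rw [hrun.update l k hk ω]
  have h := M.regObjective_add_ge (θ l k ω) (P.α l k • gradEst P θ X H l k ω) (P.lam_nonneg l)
  rw [inner_smul_right, norm_smul, mul_pow, Real.norm_eq_abs, sq_abs] at h
  unfold ascentTerm
  linarith

theorem integrable_ascentTerm (hk : k < P.T l) {a C₁ : ℝ} (ha : 0 ≤ a)
    (hb : ∀ᵐ ω ∂μ, ‖gradEst P θ X H l k ω‖ ≤ C₁) :
    Integrable (ascentTerm M P θ X H l k a) μ :=
  Integrable.of_bound (measurable_ascentTerm (hrun.sigmaIter_le hk.le)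
    (hrun.sigmaTraj_le hk) a).aestronglyMeasurable _
    (hb.mono fun _ h => abs_ascentTerm_le ha h)

theorem condExp_ascentTerm_sigmaHist (hk : k < P.T l) {a C₁ : ℝ} (ha : 0 ≤ a)
    (hb : ∀ᵐ ω ∂μ, ‖gradEst P θ X H l k ω‖ ≤ C₁) :
    μ[ascentTerm M P θ X H l k a | sigmaHist P.T θ X H l k] =ᵐ[μ]
      μ[ascentTerm M P θ X H l k a | sigmaIter θ l k] := by
  refine hrun.condExp_sigmaHist_eq hk
    (g := fun τ ϑ => a * inner ℝ (gradient (M.regObjective (P.lam l)) ϑ) (P.estimator l k ϑ τ) -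
      M.smoothConst (P.lam l) / 2 * a ^ 2 * ‖P.estimator l k ϑ τ‖ ^ 2) (fun τ => ?_)
    (hrun.integrable_ascentTerm hk ha hb)
  exact measurable_mul_inner_sub (measurable_gradient _) (P.estimator_measurable l k τ) a _

theorem condExp_ascentTerm (hk : k < P.T l) {a C₁ : ℝ}
    (hb : ∀ᵐ ω ∂μ, ‖gradEst P θ X H l k ω‖ ≤ C₁) :
    ∀ᵐ ω ∂μ, (μ[ascentTerm M P θ X H l k a | sigmaIter θ l k]) ω =
      a * inner ℝ (gradient (M.regObjective (P.lam l)) (θ l k ω))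
          ((μ[gradEst P θ X H l k | sigmaIter θ l k]) ω) -
        M.smoothConst (P.lam l) / 2 * a ^ 2 *
          (μ[fun ω' => ‖gradEst P θ X H l k ω'‖ ^ 2 | sigmaIter θ l k]) ω := by
  have hm := hrun.sigmaIter_le hk.le
  have hg := measurable_gradEst_of_sigmaAlgebra (P := P) hm (hrun.sigmaTraj_le hk)
  have hG : Measurable[sigmaIter θ l k]
      fun ω => gradient (M.regObjective (P.lam l)) (θ l k ω) :=
    (measurable_gradient _).comp (comap_measurable (θ l k))
  have hgI : Integrable (gradEst P θ X H l k) μ :=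
    Integrable.of_bound hg.aestronglyMeasurable C₁ hb
  have hWI : Integrable (fun ω => ‖gradEst P θ X H l k ω‖ ^ 2) μ := by
    refine Integrable.of_bound (hg.norm.pow_const 2).aestronglyMeasurable (C₁ ^ 2) ?_
    filter_upwards [hb] with ω hω
    rw [norm_pow, norm_norm]
    gcongr
  have hUI : Integrable (fun ω => innerSL ℝ (gradient (M.regObjective (P.lam l)) (θ l k ω))
      (gradEst P θ X H l k ω)) μ := by
    refine Integrable.of_bound (((hG.mono hm le_rfl).inner hg).aestronglyMeasurable)
      (2 * (1 / (1 - M.γ) ^ 2 + P.lam l) * C₁) ?_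
    filter_upwards [hb] with ω hω
    have h1 := M.norm_gradient_regObjective_le (θ l k ω) (P.lam_nonneg l)
    exact (abs_real_inner_le_norm _ _).trans
      (mul_le_mul h1 hω (norm_nonneg _) ((norm_nonneg _).trans h1))
  have e : ascentTerm M P θ X H l k a =
      (a • fun ω => innerSL ℝ (gradient (M.regObjective (P.lam l)) (θ l k ω))
        (gradEst P θ X H l k ω)) -
      (M.smoothConst (P.lam l) / 2 * a ^ 2) • fun ω => ‖gradEst P θ X H l k ω‖ ^ 2 := rfl
  rw [e]
  -- The gradient is a function of θ, so it leaves the conditional expectation through the bilinear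
  -- form `innerSL`.
  filter_upwards [condExp_sub (hUI.smul a) (hWI.smul (M.smoothConst (P.lam l) / 2 * a ^ 2))
      (sigmaIter θ l k),
    condExp_smul (μ := μ) a (fun ω => innerSL ℝ (gradient (M.regObjective (P.lam l)) (θ l k ω))
        (gradEst P θ X H l k ω)) (sigmaIter θ l k),
    condExp_smul (μ := μ) (M.smoothConst (P.lam l) / 2 * a ^ 2)
      (fun ω => ‖gradEst P θ X H l k ω‖ ^ 2) (sigmaIter θ l k),
    condExp_bilin_of_stronglyMeasurable_left (innerSL ℝ) hG.stronglyMeasurable hUI hgI]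
    with ω g1 g2 g3 g4
  rw [g1, Pi.sub_apply, g2, g3, Pi.smul_apply, Pi.smul_apply, g4]
  rfl

end IsPhasedPGRun

end Run

/-! ### The martingale noise and the constants of the regret bound. -/

section Assembly

variable {S A : Type*} [Fintype S] [Fintype A] [Nonempty S] [Nonempty A] {Ω : Type*}
  [m0 : MeasurableSpace Ω] {M : FiniteMDP S A} {P : PhasedPGInput S A} {μ : Measure Ω}
  [IsProbabilityMeasure μ] {θ : ℕ → ℕ → Ω → Param S A} {X : ℕ → ℕ → ℕ → Ω → S × A}
  {H : ℕ → ℕ → Ω → ℕ} {l : ℕ}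

open Classical in
/-- The centred noise `E_{l,k} Φ - Φ` of the ascent term, for step sizes `Cα * unitStep k`. -/
noncomputable def ascentNoise (M : FiniteMDP S A) (P : PhasedPGInput S A) (μ : Measure Ω)
    (θ : ℕ → ℕ → Ω → Param S A) (X : ℕ → ℕ → ℕ → Ω → S × A) (H : ℕ → ℕ → Ω → ℕ) (l : ℕ)
    (Cα : ℝ) (k : ℕ) : Ω → ℝ :=
  if k < P.T l then
    μ[ascentTerm M P θ X H l k (Cα * unitStep k) | sigmaIter θ l k] -
      ascentTerm M P θ X H l k (Cα * unitStep k)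
  else 0

/-- The filtration of the histories within phase `l`, constant from time `T_l` on. -/
noncomputable def IsPhasedPGRun.filtration (hrun : IsPhasedPGRun M P μ θ X H) (l : ℕ) :
    Filtration ℕ m0 where
  seq k := sigmaHist P.T θ X H l (min k (P.T l))
  mono' _ _ hij := sigmaHist_mono (min_le_min_right _ hij)
  le' _ := hrun.sigmaHist_le (min_le_right _ _)

/-- Almost sure bound on the increments of the noise. -/
noncomputable def noiseBound (M : FiniteMDP S A) (lam C₁ Cα : ℝ) (k : ℕ) : ℝ :=
  2 * (Cα * unitStep k * (2 * (1 / (1 - M.γ) ^ 2 + lam)) * C₁ +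
    M.smoothConst lam / 2 * (Cα * unitStep k) ^ 2 * C₁ ^ 2)

/-- From (p+q)² ≤ 2p² + 2q², the linear part gives the 32 in C_l. The quartic part gives 2, reduced
to 1/2 by `unitStep k ^ 2 ≤ 1/4`; the remaining squares sum to at most 1. -/
theorem sum_noiseBound_sq_le (M : FiniteMDP S A) (lam C₁ Cα : ℝ) (n : ℕ) :
    ∑ k ∈ Finset.range n, noiseBound M lam C₁ Cα k ^ 2 ≤ M.constC C₁ Cα lam := by
  have h : ∀ k, noiseBound M lam C₁ Cα k ^ 2 ≤ M.constC C₁ Cα lam * unitStep k ^ 2 := by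
    intro k
    have h1 := add_sq_le (a := 2 * (Cα * unitStep k * (2 * (1 / (1 - M.γ) ^ 2 + lam)) * C₁))
      (b := 2 * (M.smoothConst lam / 2 * (Cα * unitStep k) ^ 2 * C₁ ^ 2))
    have h2 : unitStep k ^ 2 ≤ 1 / 4 := by
      nlinarith [unitStep_pos k, unitStep_le_half k]
    have h3 : 0 ≤ 2 * (M.smoothConst lam ^ 2 * C₁ ^ 4 * Cα ^ 4) * unitStep k ^ 2 := by positivity
    have h4 := mul_le_mul_of_nonneg_left h2 h3
    unfold noiseBound FiniteMDP.constC
    linarith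
  refine (Finset.sum_le_sum fun k _ => h k).trans ?_
  rw [← Finset.mul_sum]
  refine mul_le_of_le_one_right ?_ (sum_unitStep_sq_le_one n)
  unfold FiniteMDP.constC
  positivity

namespace IsPhasedPGRun

variable (hrun : IsPhasedPGRun M P μ θ X H)
include hrun

/-- The noise is centred given θ^{l,k} alone, yet it is a martingale difference for the whole
history because conditional independence identifies the two conditional expectations. It is zero
after the phase, so an inequality for infinite sequences applies. The threshold makes the tail
exactly δ/2. -/
theorem measure_exists_noise_ge_le {C₁ Cα δ : ℝ}
    (hb : ∀ k < P.T l, ∀ᵐ ω ∂μ, ‖gradEst P θ X H l k ω‖ ≤ C₁) (hC₁ : 0 < C₁) (hCα : 0 < Cα)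
    (hδ : 0 < δ) (hδ1 : δ < 1) :
    μ.real {ω | ∃ k ≤ P.T l, √(2 * M.constC C₁ Cα (P.lam l) * Real.log (2 / δ)) ≤
      ∑ j ∈ Finset.range k, ascentNoise M P μ θ X H l Cα j ω} ≤ δ / 2 := by
  have hp := M.one_sub_γ_pos
  have hβ := M.smoothConst_pos (P.lam_nonneg l)
  have hlam := P.lam_nonneg l
  have hV : 0 < M.constC C₁ Cα (P.lam l) := by
    unfold FiniteMDP.constC
    positivity
  have ha : ∀ k, 0 ≤ Cα * unitStep k := fun k => mul_nonneg hCα.le (unitStep_pos k).le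
  have hlog : 0 ≤ Real.log (2 / δ) := Real.log_nonneg (by rw [le_div_iff₀ hδ]; linarith)
  have hseq : ∀ k, k ≤ P.T l → hrun.filtration l k = sigmaHist P.T θ X H l k := fun k hk => by
    change sigmaHist P.T θ X H l (min k (P.T l)) = _
    rw [min_eq_left hk]
  have hm : ∀ k, StronglyMeasurable[hrun.filtration l (k + 1)]
      (ascentNoise M P μ θ X H l Cα k) := by
    intro k
    unfold ascentNoise
    split_ifs with hk
    · rw [hseq (k + 1) hk]
      have h1 : sigmaIter θ l k ≤ sigmaHist P.T θ X H l (k + 1) :=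
        sigmaIter_le_sigmaHist k.le_succ
      exact (stronglyMeasurable_condExp.mono h1).sub (measurable_ascentTerm h1
        (sigmaTraj_le_sigmaHist k.lt_succ_self) _).stronglyMeasurable
    · exact stronglyMeasurable_zero
  have hbd : ∀ k, ∀ᵐ ω ∂μ, |ascentNoise M P μ θ X H l Cα k ω| ≤
      noiseBound M (P.lam l) C₁ Cα k := by
    intro k
    have hak := ha k
    have hnn : 0 ≤ Cα * unitStep k * (2 * (1 / (1 - M.γ) ^ 2 + P.lam l)) * C₁ +
        M.smoothConst (P.lam l) / 2 * (Cα * unitStep k) ^ 2 * C₁ ^ 2 := by positivity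
    unfold ascentNoise noiseBound
    split_ifs with hk
    · have h1 := (hb k hk).mono fun ω h => abs_ascentTerm_le (M := M) hak h
      have h2 := ae_bdd_abs_condExp_of_ae_bdd_abs (m := sigmaIter θ l k) h1
      filter_upwards [h1, h2] with ω g1 g2
      rw [Pi.sub_apply]
      exact (abs_sub _ _).trans (by linarith)
    · exact Filter.Eventually.of_forall fun ω => by simpa using hnn
  have h0 : ∀ k, μ[ascentNoise M P μ θ X H l Cα k | hrun.filtration l k] =ᵐ[μ] 0 := by
    intro k
    unfold ascentNoise
    split_ifs with hk
    · rw [hseq k hk.le]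
      have hle := hrun.sigmaHist_le hk.le
      have hI := hrun.integrable_ascentTerm hk (ha k) (hb k hk)
      have h1 : μ[μ[ascentTerm M P θ X H l k (Cα * unitStep k) | sigmaIter θ l k] |
          sigmaHist P.T θ X H l k] =
            μ[ascentTerm M P θ X H l k (Cα * unitStep k) | sigmaIter θ l k] :=
        condExp_of_stronglyMeasurable hle
          (stronglyMeasurable_condExp.mono (sigmaIter_le_sigmaHist le_rfl)) integrable_condExp
      filter_upwards [condExp_sub (integrable_condExp (m := sigmaIter θ l k)) hI
        (sigmaHist P.T θ X H l k), hrun.condExp_ascentTerm_sigmaHist hk (ha k) (hb k hk)]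
        with ω g1 g2
      rw [g1, Pi.sub_apply, h1, g2, sub_self, Pi.zero_apply]
    · rw [condExp_zero]
  refine (measure_exists_sum_range_ge_le hm hbd h0 hV (sum_noiseBound_sq_le M _ _ _ (P.T l))
    (Real.sqrt_nonneg _)).trans (le_of_eq ?_)
  rw [Real.sq_sqrt (by positivity)]
  have e : -(2 * M.constC C₁ Cα (P.lam l) * Real.log (2 / δ)) /
      (2 * M.constC C₁ Cα (P.lam l)) = Real.log (δ / 2) := by
    rw [← inv_div 2 δ, Real.log_inv]
    field_simp
  rw [e, Real.exp_log (by positivity)]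

/-- The expected ascent in one step, up to noise. -/
theorem regObjective_ascent {C C₁ C₂ M₁ M₂ Cα : ℝ} {d : ℕ → ℝ}
    (hest : GradEstAssumption M P μ θ X H l C C₁ C₂ M₁ M₂)
    (hd : ∀ k < P.T l, ∀ᵐ ω ∂μ,
      C₂ * ‖gradient (M.regObjective (P.lam l)) (θ l k ω)‖ ^ 2 - d k ≤
        inner ℝ (gradient (M.regObjective (P.lam l)) (θ l k ω))
          ((μ[gradEst P θ X H l k | sigmaIter θ l k]) ω))
    (hCα : 0 < Cα) (hCα_le : Cα ≤ C₂ / (M₂ * M.smoothConst (P.lam l)))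
    (hα : ∀ k < P.T l, P.α l k = Cα * unitStep k) {k : ℕ} (hk : k < P.T l) :
    ∀ᵐ ω ∂μ, M.regObjective (P.lam l) (θ l k ω) +
        (3 / 4 * (Cα * unitStep k) * C₂ *
            ‖gradient (M.regObjective (P.lam l)) (θ l k ω)‖ ^ 2 - Cα * unitStep k * d k -
          M.smoothConst (P.lam l) / 2 * M₁ * (Cα * unitStep k) ^ 2) -
        ascentNoise M P μ θ X H l Cα k ω ≤
      M.regObjective (P.lam l) (θ l (k + 1) ω) := by
  have hβ := M.smoothConst_pos (P.lam_nonneg l)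
  have hM₂ := hest.M₂_pos
  have hau := unitStep_pos k
  have hau2 := unitStep_le_half k
  rw [le_div_iff₀ (by positivity)] at hCα_le
  filter_upwards [hd k hk, hest.second_moment k hk,
    hrun.condExp_ascentTerm hk (a := Cα * unitStep k) (hest.bounded k hk)] with ω g1 g2 g3
  have h := hrun.regObjective_succ_ge hk ω
  rw [hα k hk] at h
  simp only [ascentNoise, if_pos hk, Pi.sub_apply]
  rw [g3]
  set n2 := ‖gradient (M.regObjective (P.lam l)) (θ l k ω)‖ ^ 2 with hn2
  have hn : 0 ≤ n2 := sq_nonneg _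
  set a := Cα * unitStep k with ha
  have ha0 : 0 < a := by positivity
  have h1 := mul_le_mul_of_nonneg_left g1 ha0.le
  have h2 := mul_le_mul_of_nonneg_left g2
    (by positivity : 0 ≤ M.smoothConst (P.lam l) / 2 * a ^ 2)
  -- As a ≤ Cα/2, the part of the second moment proportional to ‖∇L‖² consumes only a quarter of the
  -- expected gain; hence the 3/4.
  have h3 : M.smoothConst (P.lam l) / 2 * a ^ 2 * (M₂ * n2) ≤ 1 / 4 * a * C₂ * n2 := by
    have e1 : a * (M₂ * M.smoothConst (P.lam l)) ≤ C₂ / 2 := by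
      have e2 : a ≤ Cα * (1 / 2) := mul_le_mul_of_nonneg_left hau2 hCα.le
      have e3 := mul_le_mul_of_nonneg_right e2
        (by positivity : 0 ≤ M₂ * M.smoothConst (P.lam l))
      linarith
    have e4 := mul_le_mul_of_nonneg_left e1 (by positivity : 0 ≤ a * n2 / 2)
    linarith
  linarith

end IsPhasedPGRun

namespace FiniteMDP

theorem constE_mul_sq (M : FiniteMDP S A) {Cα ε lam : ℝ} (hlam : lam = ε * (1 - M.γ) / 2) :
    M.constE Cα * ε ^ 2 =
      Cα * (lam / (2 * ((Fintype.card S : ℝ) * Fintype.card A))) ^ 2 := by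
  have hS : (0 : ℝ) < Fintype.card S := by exact_mod_cast Fintype.card_pos
  have hA : (0 : ℝ) < Fintype.card A := by exact_mod_cast Fintype.card_pos
  rw [constE, hlam]
  field_simp
  ring

theorem constE_pos (M : FiniteMDP S A) {Cα : ℝ} (hCα : 0 < Cα) : 0 < M.constE Cα := by
  have hS : (0 : ℝ) < Fintype.card S := by exact_mod_cast Fintype.card_pos
  have hA : (0 : ℝ) < Fintype.card A := by exact_mod_cast Fintype.card_pos
  have := M.one_sub_γ_pos
  unfold constE
  positivity

end FiniteMDP

/-- The factor 9/4 is chosen to turn 16/9 into the 4 of the final bound. -/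
theorem sqrt_add_three_le (K : ℕ) : √((K : ℝ) + 3) ≤ 9 / 4 * √((K : ℝ) + 1) := by
  have hK : (0 : ℝ) ≤ K := K.cast_nonneg
  rw [Real.sqrt_le_left (by positivity), mul_pow, Real.sq_sqrt (by positivity)]
  linarith

theorem gap_bound_le (M : FiniteMDP S A) {Cα C₂ ε lam Z : ℝ} (hlam : lam = ε * (1 - M.γ) / 2)
    (hCα : 0 < Cα) (hC₂ : 0 < C₂) (hε : 0 < ε) (hZ : 0 ≤ Z) (K : ℕ) :
    16 / 9 * (1 / (1 - M.γ)) * Z / (C₂ * (Cα * unitStep K) *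
        (lam / (2 * ((Fintype.card S : ℝ) * Fintype.card A))) ^ 2) ≤
      4 * Z / ((1 - M.γ) * C₂ * M.constE Cα * ε ^ 2) * √((K : ℝ) + 1) *
        Real.logb 2 ((K : ℝ) + 3) := by
  have hp := M.one_sub_γ_pos
  have hE := M.constE_pos hCα
  have hu := two_pos.trans_le (two_le_sqrt_mul_logb K)
  have hlg : 0 ≤ Real.logb 2 ((K : ℝ) + 3) :=
    Real.logb_nonneg (by norm_num) (by linarith [K.cast_nonneg (α := ℝ)])
  have e : C₂ * (Cα * unitStep K) *
      (lam / (2 * ((Fintype.card S : ℝ) * Fintype.card A))) ^ 2 =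
      C₂ * (M.constE Cα * ε ^ 2) / (√((K : ℝ) + 3) * Real.logb 2 ((K : ℝ) + 3)) := by
    rw [M.constE_mul_sq hlam, unitStep]
    ring
  rw [e, div_div_eq_mul_div]
  calc _ = 16 / 9 * Z / ((1 - M.γ) * C₂ * M.constE Cα * ε ^ 2) *
        (√((K : ℝ) + 3) * Real.logb 2 ((K : ℝ) + 3)) := by
        field_simp
    _ ≤ 16 / 9 * Z / ((1 - M.γ) * C₂ * M.constE Cα * ε ^ 2) *
        (9 / 4 * √((K : ℝ) + 1) * Real.logb 2 ((K : ℝ) + 3)) := by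
        have := sqrt_add_three_le K
        gcongr
    _ = _ := by ring

/-- Since δ < 1, the ratio log(2/δ)/log 2 exceeds 1, so D_l may be multiplied by its square root.
This allows √(log(2/δ)) to be factored out. -/
theorem main_bound_le_constU (M : FiniteMDP S A) {C C₁ C₂ M₁ Cα lam ε δ : ℝ} {θ₀ : Param S A}
    (hD : 0 ≤ M.constD C M₁ Cα lam θ₀) (hCα : 0 < Cα) (hC₂ : 0 < C₂) (hε : 0 < ε)
    (hδ : 0 < δ) (hδ1 : δ < 1) (K : ℕ) :
    4 * (M.constD C M₁ Cα lam θ₀ + √(2 * M.constC C₁ Cα lam * Real.log (2 / δ))) /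
        ((1 - M.γ) * C₂ * M.constE Cα * ε ^ 2) * √((K : ℝ) + 1) * Real.logb 2 ((K : ℝ) + 3) ≤
      M.constU C C₁ C₂ M₁ Cα lam θ₀ *
        (√((K : ℝ) + 1) * Real.logb 2 ((K : ℝ) + 3) * √(Real.log (2 / δ)) / ε ^ 2) := by
  have hp := M.one_sub_γ_pos
  have hE := M.constE_pos hCα
  have hlg : 0 ≤ Real.logb 2 ((K : ℝ) + 3) :=
    Real.logb_nonneg (by norm_num) (by linarith [K.cast_nonneg (α := ℝ)])
  have hl2 : 0 < Real.log 2 := Real.log_pos (by norm_num)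
  have hle : √(Real.log 2) ≤ √(Real.log (2 / δ)) :=
    Real.sqrt_le_sqrt (Real.log_le_log two_pos (by rw [le_div_iff₀ hδ]; linarith))
  have hV : 0 ≤ 2 * M.constC C₁ Cα lam := by
    unfold FiniteMDP.constC
    positivity
  have h1 : M.constD C M₁ Cα lam θ₀ ≤
      M.constD C M₁ Cα lam θ₀ / √(Real.log 2) * √(Real.log (2 / δ)) := by
    rw [div_mul_eq_mul_div, le_div_iff₀ (Real.sqrt_pos.2 hl2)]
    exact mul_le_mul_of_nonneg_left hle hD
  calc _ ≤ 4 * ((M.constD C M₁ Cα lam θ₀ / √(Real.log 2) + √(2 * M.constC C₁ Cα lam)) *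
        √(Real.log (2 / δ))) / ((1 - M.γ) * C₂ * M.constE Cα * ε ^ 2) * √((K : ℝ) + 1) *
          Real.logb 2 ((K : ℝ) + 3) := by
        rw [Real.sqrt_mul hV, add_mul]
        gcongr
    _ = _ := by
        unfold FiniteMDP.constU
        field_simp

theorem one_add_log_le (K : ℕ) :
    1 + Real.log ((K : ℝ) + 1) ≤ 2 * Real.log ((K : ℝ) + 3) := by
  have hK : (0 : ℝ) ≤ K := K.cast_nonneg
  have h1 : Real.log ((K : ℝ) + 1) ≤ Real.log ((K : ℝ) + 3) :=
    Real.log_le_log (by linarith) (by linarith)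
  have h2 : 1 ≤ Real.log ((K : ℝ) + 3) := by
    rw [Real.le_log_iff_exp_le (by linarith)]
    linarith [Real.exp_one_lt_d9]
  linarith

end Assembly

/-! ### The regret bound. -/

theorem theorem1 {S A : Type*} [Fintype S] [Fintype A] (M : FiniteMDP S A)
    {Ω : Type*} [MeasurableSpace Ω] (μ : Measure Ω) [IsProbabilityMeasure μ]
    (P : PhasedPGInput S A)
    (θ : ℕ → ℕ → Ω → Param S A) (X : ℕ → ℕ → ℕ → Ω → S × A) (H : ℕ → ℕ → Ω → ℕ)
    (hrun : IsPhasedPGRun M P μ θ X H)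
    (l : ℕ) (C C₁ C₂ M₁ M₂ : ℝ)
    (hest : GradEstAssumption M P μ θ X H l C C₁ C₂ M₁ M₂)
    (Cα : ℝ) (hCα_pos : 0 < Cα) (hCα_le : Cα ≤ C₂ / (M₂ * M.smoothConst (P.lam l)))
    (hα : ∀ k < P.T l, P.α l k = Cα * (1 / (√((k : ℝ) + 3) * Real.logb 2 ((k : ℝ) + 3))))
    (ε : ℝ) (hε : 0 < ε) (hlam : P.lam l = ε * (1 - M.γ) / 2)
    (πstar : S → A → ℝ) (hπstar : M.IsOptimal πstar)
    (δ : ℝ) (hδ_pos : 0 < δ) (hδ_lt : δ < 1) :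
    1 - δ ≤ μ.real {ω | ∀ K : ℕ, K < P.T l →
      phaseRegret M μ θ X H l K ω ≤
        4 * (M.constD C M₁ Cα (P.lam l) (θ l 0 ω) +
            √(2 * M.constC C₁ Cα (P.lam l) * Real.log (2 / δ))) /
          ((1 - M.γ) * C₂ * M.constE Cα * ε ^ 2) *
          √((K : ℝ) + 1) * Real.logb 2 ((K : ℝ) + 3)
        + ε * ((K : ℝ) + 1) * M.mismatch πstar
        + (M.γ + M.γ * Real.log ((K : ℝ) + 1)) / (1 - M.γ) ∧
      phaseRegret M μ θ X H l K ω ≤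
        M.constU C C₁ C₂ M₁ Cα (P.lam l) (θ l 0 ω) *
          (√((K : ℝ) + 1) * Real.logb 2 ((K : ℝ) + 3) * √(Real.log (2 / δ)) / ε ^ 2)
        + ((K : ℝ) + 1) * M.mismatch πstar * ε
        + 2 * M.γ / (1 - M.γ) * Real.log ((K : ℝ) + 3)} := by
  have hp := M.one_sub_γ_pos
  -- Both spaces are nonempty because ρ and the policy each sum to one.
  have hS : Nonempty S := by
    by_contra h
    rw [not_nonempty_iff] at h
    simpa using M.ρ_sum
  have hA : Nonempty A := by
    by_contra h
    rw [not_nonempty_iff] at h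
    simpa using hπstar.1.2 hS.some
  have hα' : ∀ k < P.T l, P.α l k = Cα * unitStep k := hα
  have hC₂ := hest.C₂_pos
  have hM₁ := hest.M₁_pos
  have hβ := M.smoothConst_pos (P.lam_nonneg l)
  obtain ⟨d, hdC, hd⟩ := hest.nearly_unbiased
  have hopt := hπstar.optValue_eq
  have hFle : ∀ ϑ : Param S A, M.F (softmaxPolicy ϑ) ≤ M.optValue := fun ϑ => by
    rw [hopt]; exact hπstar.2 _ (isPolicy_softmaxPolicy ϑ)
  set N := √(2 * M.constC C₁ Cα (P.lam l) * Real.log (2 / δ)) with hN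
  set κ := P.lam l / (2 * ((Fintype.card S : ℝ) * Fintype.card A)) with hκ
  have hcS : (0 : ℝ) < Fintype.card S := by exact_mod_cast Fintype.card_pos
  have hcA : (0 : ℝ) < Fintype.card A := by exact_mod_cast Fintype.card_pos
  have hlam_pos : 0 < P.lam l := by rw [hlam]; positivity
  have hκ_pos : 0 < κ := by positivity
  have hg1 : 1 ≤ 1 / (1 - M.γ) := (one_le_div hp).2 (by linarith [M.γ_nonneg])
  have hbad := hrun.measure_exists_noise_ge_le hest.bounded hest.C₁_pos hCα_pos hδ_pos hδ_lt
  set Bad : Set Ω := {ω | ∃ k ≤ P.T l, N ≤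
    ∑ j ∈ Finset.range k, ascentNoise M P μ θ X H l Cα j ω} with hBad
  set Good : Set Ω := _
  change 1 - δ ≤ μ.real Good
  have hstep := ae_all_iff.2 fun k => Filter.eventually_imp_distrib_left.2
    fun hk : k < P.T l => hrun.regObjective_ascent hest hd hCα_pos hCα_le hα' hk
  have htrunc := ae_all_iff.2 fun k => Filter.eventually_imp_distrib_left.2
    fun hk : k < P.T l => hrun.F_le_truncValue_add hk (hest.length k hk)
  -- Outside `Bad` and a null set the argument is pathwise, and works for all K together.
  have hcover : ∀ᵐ ω ∂μ, ω ∈ Good ∪ Bad := by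
    filter_upwards [hstep, htrunc] with ω h1 h2
    by_cases hω : ω ∈ Bad
    · exact Or.inr hω
    refine Or.inl fun K hK => ?_
    have hnoise : ∀ k ≤ K + 1, ∑ j ∈ Finset.range k, ascentNoise M P μ θ X H l Cα j ω ≤ N := by
      intro k hk
      by_contra hlt
      exact hω ⟨k, by omega, (not_le.1 hlt).le⟩
    have hcore := sum_gap_le (v := fun k => M.regObjective (P.lam l) (θ l k ω))
      (f := fun k => M.F (softmaxPolicy (θ l k ω)))
      (G := fun k => ‖gradient (M.regObjective (P.lam l)) (θ l k ω)‖) (d := d)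
      (ξ := fun k => ascentNoise M P μ θ X H l Cα k ω) (Fs := M.optValue)
      (g := 1 / (1 - M.γ)) (Cα := Cα) (C := C) (C₂ := C₂)
      (b := M.smoothConst (P.lam l) / 2 * M₁) (N := N) (κ := κ) (e := ε * M.mismatch πstar)
      (K := K) hCα_pos hC₂ hest.C_pos.le (by positivity) hκ_pos hg1
      (mul_nonneg hε.le (M.mismatch_nonneg _)) (Real.sqrt_nonneg _)
      (fun k hk => h1 k (by omega)) hnoise
      ((Finset.sum_le_sum_of_subset_of_nonneg (Finset.range_mono hK)
        fun _ _ _ => sq_nonneg _).trans hdC)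
      (fun k => M.regObjective_le_F _ (P.lam_nonneg l)) (fun k => hFle _)
      (fun k => by
        rw [hopt]
        linarith [M.F_le hπstar.1, M.F_nonneg (isPolicy_softmaxPolicy (θ l k ω))])
      (fun k hk => by
        rw [hopt]
        refine (M.F_sub_le_of_norm_gradient_le (θ l k ω) (P.lam_nonneg l) hk hπstar.1).trans ?_
        refine mul_le_mul_of_nonneg_right ?_ (M.mismatch_nonneg _)
        -- Here λ/(1−γ) = ε/2, and half of the allowance ε is given away.
        rw [hlam, div_le_iff₀ hp]
        nlinarith)
    have hD0 : 0 ≤ M.optValue - M.regObjective (P.lam l) (θ l 0 ω) := by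
      linarith [hFle (θ l 0 ω), M.regObjective_le_F (θ l 0 ω) (P.lam_nonneg l)]
    have hb0 : 0 ≤ M.smoothConst (P.lam l) / 2 * M₁ * Cα ^ 2 := by positivity
    have hC0 : 0 ≤ C * Cα ^ 2 := mul_nonneg hest.C_pos.le (sq_nonneg _)
    -- D_l carries βM₁ where (β/2)M₁ suffices.
    have hZle : C * Cα ^ 2 + M.smoothConst (P.lam l) / 2 * M₁ * Cα ^ 2 +
        (M.optValue - M.regObjective (P.lam l) (θ l 0 ω)) + N ≤
          M.constD C M₁ Cα (P.lam l) (θ l 0 ω) + N := by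
      unfold FiniteMDP.constD
      linarith
    have hD : 0 ≤ M.constD C M₁ Cα (P.lam l) (θ l 0 ω) := by
      unfold FiniteMDP.constD
      linarith
    have hDN : 0 ≤ M.constD C M₁ Cα (P.lam l) (θ l 0 ω) + N :=
      add_nonneg hD (Real.sqrt_nonneg _)
    have hu := unitStep_pos K
    have hmain : ∑ k ∈ Finset.range (K + 1), (M.optValue - M.F (softmaxPolicy (θ l k ω))) ≤
        4 * (M.constD C M₁ Cα (P.lam l) (θ l 0 ω) + N) /
          ((1 - M.γ) * C₂ * M.constE Cα * ε ^ 2) *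
          √((K : ℝ) + 1) * Real.logb 2 ((K : ℝ) + 3) +
        ε * ((K : ℝ) + 1) * M.mismatch πstar := by
      refine hcore.trans (add_le_add ?_ (le_of_eq (by ring)))
      refine le_trans ?_ (gap_bound_le M hlam hCα_pos hC₂ hε hDN K)
      gcongr
    have hharm : ∑ k ∈ Finset.range (K + 1), 1 / ((k : ℝ) + 1) ≤ 1 + Real.log ((K : ℝ) + 1) := by
      have := harmonic_le_one_add_log (K + 1)
      rw [harmonic] at this
      push_cast at this
      simpa [one_div] using this
    have hreg : phaseRegret M μ θ X H l K ω ≤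
        4 * (M.constD C M₁ Cα (P.lam l) (θ l 0 ω) + N) /
          ((1 - M.γ) * C₂ * M.constE Cα * ε ^ 2) *
          √((K : ℝ) + 1) * Real.logb 2 ((K : ℝ) + 3) +
        ε * ((K : ℝ) + 1) * M.mismatch πstar +
        (M.γ + M.γ * Real.log ((K : ℝ) + 1)) / (1 - M.γ) := by
      calc phaseRegret M μ θ X H l K ω ≤ ∑ k ∈ Finset.range (K + 1),
            ((M.optValue - M.F (softmaxPolicy (θ l k ω))) +
              M.γ / (1 - M.γ) * (1 / ((k : ℝ) + 1))) := by
            refine Finset.sum_le_sum fun k hk => ?_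
            rw [Finset.mem_range] at hk
            linarith [h2 k (by omega)]
        _ ≤ _ := by
            rw [Finset.sum_add_distrib, ← Finset.mul_sum]
            refine add_le_add hmain ((mul_le_mul_of_nonneg_left hharm
              (div_nonneg M.γ_nonneg hp.le)).trans (le_of_eq (by ring)))
    refine ⟨hreg, hreg.trans ?_⟩
    refine add_le_add (add_le_add (main_bound_le_constU M hD hCα_pos hC₂ hε hδ_pos hδ_lt K)
      (le_of_eq (by ring))) ?_
    calc _ = M.γ / (1 - M.γ) * (1 + Real.log ((K : ℝ) + 1)) := by ring
      _ ≤ M.γ / (1 - M.γ) * (2 * Real.log ((K : ℝ) + 3)) :=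
          mul_le_mul_of_nonneg_left (one_add_log_le K) (div_nonneg M.γ_nonneg hp.le)
      _ = _ := by ring
  -- Subadditivity suffices, so `Good` need not be measurable; `Bad` has probability at most δ/2.
  have huniv : μ.real (Good ∪ Bad) = 1 := by
    have h : (Good ∪ Bad : Set Ω) =ᵐ[μ] Set.univ := Filter.eventuallyEq_univ.2 hcover
    rw [measureReal_congr h, probReal_univ]
  have := measureReal_union_le (μ := μ) Good Bad
  linarith
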